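/- For positive integers $k, s, n$ let $r_{k,s}(n)$ be the number of ordered $s$-tuples $(x_1,\dots,x_s)$ of positive integers with $x_1^k+\cdots+x_s^k=n$, and put $r_k(n)=r_{k,k}(n)$. Let $k\ge 4$ be an integer. Then, for integers $n\ge 1$, $$\sum_{m=1}^{n} r_k(m)=\Gamma\Big(\frac{k+1}{k}\Big)^{k} n-\frac{k}{2}\cdot\frac{\Gamma\big(\frac{k+1}{k}\big)^{k-1}}{\Gamma\big(\frac{2k-1}{k}\big)}\,n^{1-\frac1k}+O\Big(n^{\frac{k^2-k-1}{k^2}}\Big),$$ and, equivalently, for real $x\ge 1$, $$\sum_{1\le m\le x} r_k(m)=\Gamma\Big(\frac{k+1}{k}\Big)^{k} x-\frac{k}{2}\cdot\frac{\Gamma\big(\frac{k+1}{k}\big)^{k-1}}{\Gamma\big(\frac{2k-1}{k}\big)}\,x^{1-\frac1k}+O\Big(x^{\frac{k^2-k-1}{k^2}}\Big),$$ where the implied constants depend only on $k$. -/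

import Mathlib

/-- The set of ordered `s`-tuples of positive integers whose `k`-th powers sum to `n`. -/
def powerReps (k s n : ℕ) : Set (Fin s → ℕ) :=
  {x | (∀ i, 0 < x i) ∧ ∑ i, x i ^ k = n}

/-- For `k ≥ 1` there are only finitely many representations, so that counting them with
`Set.ncard` gives their true number. -/
theorem powerReps_finite {k : ℕ} (hk : k ≠ 0) (s n : ℕ) : (powerReps k s n).Finite := by
  refine (Set.finite_Iic (fun _ : Fin s => n)).subset ?_
  rintro x ⟨-, hx⟩ i
  calc x i ≤ x i ^ k := Nat.le_self_pow hk _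
    _ ≤ ∑ j, x j ^ k :=
      Finset.single_le_sum (f := fun j => x j ^ k) (fun _ _ => Nat.zero_le _) (Finset.mem_univ i)
    _ = n := hx

/-- `r_{k,s}(n)`: the number of ordered representations of `n` as the sum of `s` positive
`k`-th powers. -/
noncomputable def powerRepCount (k s n : ℕ) : ℕ := (powerReps k s n).ncard

/-- `r_k(n) = r_{k,k}(n)`. -/
noncomputable def powerRepCountDiag (k n : ℕ) : ℕ := powerRepCount k k n

/-! The summatory function counts positive lattice points in `x₁ ^ k + ⋯ + xₖ ^ k ≤ n`. More
generally, the count in `s` variables is shown to be the volume term, minus `s / 2` times the volume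
in `s - 1` variables, up to `O(n ^ ((s - 1 - 1 / k) / k))`, by induction on `s` from `2` to `k`
(`TwoTermExpansion`).

Inductive step: fixing one coordinate `m` leaves a count for `n - m ^ k`. Inserting the expansion
gives sums of `(n - m ^ k) ^ e` with `0 < e ≤ 1`. These are concave and antitone in `m`, so
Euler–Maclaurin gives the integral minus half the value at `0`, with an error governed by the value
near the right end (`abs_sum_sub_pow_rpow_le`). Beta integrals make the coefficients match.

Base case: the lattice points under `x ^ k + y ^ k = N ^ k`, with `N = n ^ (1 / k)`, require the sum
of the sawtooth over the heights of the curve to be `O(N ^ (1 - 1 / k))`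
(`exists_bound_curveSawtoothSum`). Symmetry of the curve in `x` and `y`
(`abs_curveSawtoothSum_reciprocity`) reduces the whole sum to the part left of the diagonal, and
trades the flat part, of slope about at most `1 / Q`, for a short piece next to `N`. Between them,
the slope is approximated by fractions `a / q` with `q ≤ Q`. On a block of length `q` the heights
are nearly an arithmetic progression of difference `-a / q`, so the sawtooth sums to `O(1)`.
Counting blocks by their fraction gives `O((N / Q) * log ^ 2 + Q ^ 2)`, and `Q` about `N ^ (1 / 3)`
makes this `O(N ^ (3 / 4))`. That is small enough exactly when `k ≥ 4`. -/

/-! ### Euler–Maclaurin summation for concave antitone functions -/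

/-- Along a concave antitone function, the integral over a unit interval dominates the trapezoid. -/
theorem trapezoid_le_integral_of_concaveOn {g : ℝ → ℝ} {a : ℝ} (hc : ConcaveOn ℝ (Set.Icc 0 a) g)
    (ha : AntitoneOn g (Set.Icc 0 a)) {i : ℝ} (hi : 0 ≤ i) (hia : i + 1 ≤ a) :
    (g i + g (i + 1)) / 2 ≤ ∫ t in i..(i + 1), g t := by
  have hint : IntervalIntegrable g MeasureTheory.volume i (i + 1) := by
    apply AntitoneOn.intervalIntegrable
    rw [Set.uIcc_of_le (by linarith)]
    exact ha.mono (Set.Icc_subset_Icc hi hia)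
  have h1 : ∫ t in i..(i + 1), (g i + (t - i) * (g (i + 1) - g i)) =
      (g i + g (i + 1)) / 2 := by
    rw [intervalIntegral.integral_add (by simp) (by apply Continuous.intervalIntegrable; fun_prop),
      intervalIntegral.integral_mul_const,
      intervalIntegral.integral_comp_sub_right (fun t => t) i]
    simp
    ring
  rw [← h1]
  apply intervalIntegral.integral_mono_on (by linarith)
    (by apply Continuous.intervalIntegrable; fun_prop) hint
  intro t ht
  have hi1 : i ∈ Set.Icc 0 a := ⟨hi, by linarith⟩
  have hi2 : i + 1 ∈ Set.Icc 0 a := ⟨by linarith, hia⟩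
  have := hc.2 hi1 hi2 (sub_nonneg.2 ht.2) (sub_nonneg.2 ht.1) (by ring)
  simp only [smul_eq_mul] at this
  have e : (i + 1 - t) * i + (t - i) * (i + 1) = t := by ring
  rw [e] at this
  linarith

/-- For a concave antitone function, the integral over a unit interval exceeds the trapezoid by at
most half of the second difference on its right. -/
theorem integral_le_trapezoid_add_of_concaveOn {g : ℝ → ℝ} {a : ℝ}
    (hc : ConcaveOn ℝ (Set.Icc 0 a) g) (ha : AntitoneOn g (Set.Icc 0 a)) {i : ℝ} (hi : 0 ≤ i)
    (hia : i + 2 ≤ a) :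
    ∫ t in i..(i + 1), g t ≤
      (g i + g (i + 1)) / 2 + ((g (i + 1) - g (i + 2)) - (g i - g (i + 1))) / 2 := by
  have hint : IntervalIntegrable g MeasureTheory.volume i (i + 1) := by
    apply AntitoneOn.intervalIntegrable
    rw [Set.uIcc_of_le (by linarith)]
    exact ha.mono (Set.Icc_subset_Icc hi (by linarith))
  -- The comparison function is the secant through `i + 1` and `i + 2`, extended to the left;
  -- concavity keeps `g` below it there.
  have h1 : ∫ t in i..(i + 1), (g (i + 1) + (g (i + 1) - g (i + 2)) -
        (t - i) * (g (i + 1) - g (i + 2))) =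
      (g i + g (i + 1)) / 2 + ((g (i + 1) - g (i + 2)) - (g i - g (i + 1))) / 2 := by
    rw [intervalIntegral.integral_sub (by simp) (by apply Continuous.intervalIntegrable; fun_prop),
      intervalIntegral.integral_mul_const,
      intervalIntegral.integral_comp_sub_right (fun t => t) i]
    simp
    ring
  rw [← h1]
  apply intervalIntegral.integral_mono_on (by linarith) hint
    (by apply Continuous.intervalIntegrable; fun_prop)
  intro t ht
  have hp : 0 < i + 2 - t := by linarith [ht.2]
  have hi1 : t ∈ Set.Icc 0 a := ⟨by linarith [ht.1], by linarith [ht.2]⟩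
  have hi2 : i + 2 ∈ Set.Icc 0 a := ⟨by linarith, hia⟩
  have := hc.2 hi1 hi2 (one_div_pos.2 hp).le (div_nonneg (sub_nonneg.2 ht.2) hp.le)
    (by field_simp; ring)
  simp only [smul_eq_mul] at this
  have e : 1 / (i + 2 - t) * t + (i + 1 - t) / (i + 2 - t) * (i + 2) = i + 1 := by
    field_simp; ring
  rw [e] at this
  have h2 : g t + (i + 1 - t) * g (i + 2) ≤ (i + 2 - t) * g (i + 1) := by
    have := mul_le_mul_of_nonneg_left this hp.le
    have e2 : (i + 2 - t) * (1 / (i + 2 - t) * g t + (i + 1 - t) / (i + 2 - t) * g (i + 2)) =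
      g t + (i + 1 - t) * g (i + 2) := by field_simp
    linarith
  linarith

/-- First-order Euler–Maclaurin summation for a nonnegative concave antitone function, with the
error controlled by the value near the right end of the range. -/
theorem abs_sum_sub_integral_le_of_concaveOn {g : ℝ → ℝ} {a : ℝ} (h0 : 0 ≤ a)
    (hc : ConcaveOn ℝ (Set.Icc 0 a) g) (ha : AntitoneOn g (Set.Icc 0 a)) (hg : 0 ≤ g a) :
    |∑ m ∈ Finset.Icc 1 ⌊a⌋₊, g m - ((∫ t in (0 : ℝ)..a, g t) - g 0 / 2)| ≤
      2 * g ((⌊a⌋₊ - 1 : ℕ)) := by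
  have hpos : ∀ t ∈ Set.Icc 0 a, 0 ≤ g t := fun t ht =>
    hg.trans (ha ht ⟨h0, le_rfl⟩ ht.2)
  have hint : ∀ u ∈ Set.Icc 0 a, ∀ v ∈ Set.Icc 0 a,
      IntervalIntegrable g MeasureTheory.volume u v := by
    intro u hu v hv
    apply AntitoneOn.intervalIntegrable
    exact ha.mono (Set.uIcc_subset_Icc hu hv)
  have hfl : (⌊a⌋₊ : ℝ) ≤ a := Nat.floor_le h0
  have hfl2 : a < ⌊a⌋₊ + 1 := Nat.lt_floor_add_one a
  have tail : ∀ u ∈ Set.Icc 0 a, a ≤ u + 1 → 0 ≤ ∫ t in u..a, g t ∧ ∫ t in u..a, g t ≤ g u := by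
    intro u hu hu1
    constructor
    · exact intervalIntegral.integral_nonneg hu.2 fun t ht => hpos t ⟨hu.1.trans ht.1, ht.2⟩
    · have : ∫ t in u..a, g t ≤ ∫ t in u..a, g u := by
        apply intervalIntegral.integral_mono_on hu.2 (hint u hu a ⟨h0, le_rfl⟩) (by simp)
        intro t ht
        exact ha hu ⟨hu.1.trans ht.1, ht.2⟩ ht.1
      rw [intervalIntegral.integral_const, smul_eq_mul] at this
      nlinarith [hpos u hu]
  rcases Nat.eq_zero_or_pos ⌊a⌋₊ with hn | hn
  · rw [hn] at hfl2 ⊢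
    obtain ⟨h1, h2⟩ := tail 0 ⟨le_rfl, h0⟩ (by simpa using hfl2.le)
    have := hpos 0 ⟨le_rfl, h0⟩
    simp only [Finset.Icc_eq_empty_of_lt Nat.zero_lt_one, Finset.sum_empty,
      Nat.zero_sub, Nat.cast_zero]
    rw [abs_le]
    constructor <;> linarith
  -- The upper trapezoid bound looks one step further right, so it is used only up to `n = ⌊a⌋₊ -
  -- 1`; the last full interval and the fractional tail are estimated directly by monotonicity.
  · obtain ⟨n, hn⟩ : ∃ n, ⌊a⌋₊ = n + 1 := ⟨⌊a⌋₊ - 1, by omega⟩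
    rw [hn] at hfl hfl2 ⊢
    simp only [Nat.add_sub_cancel]
    push_cast at hfl hfl2
    have hn0 : (0 : ℝ) ≤ n := Nat.cast_nonneg n
    -- The second differences telescope, so the accumulated error is at most half the last drop of
    -- `g`, whatever the number of intervals.
    have key : ∀ j : ℕ, j ≤ n →
        ∑ m ∈ Finset.Icc 1 j, g m ≤ (∫ t in (0 : ℝ)..j, g t) + (g j - g 0) / 2 ∧
        (∫ t in (0 : ℝ)..j, g t) + (g j - g 0) / 2 ≤ ∑ m ∈ Finset.Icc 1 j, g m +
          ((g j - g (j + 1)) - (g 0 - g 1)) / 2 := by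
      intro j
      induction j with
      | zero => intro _; simp
      | succ j ih =>
        intro hj
        obtain ⟨ih1, ih2⟩ := ih (by omega)
        have hj' : (j : ℝ) + 1 ≤ n := by exact_mod_cast hj
        have hj0 : (0 : ℝ) ≤ j := Nat.cast_nonneg j
        rw [Finset.sum_Icc_succ_top (by omega)]
        push_cast
        rw [← intervalIntegral.integral_add_adjacent_intervals
          (hint 0 ⟨le_rfl, h0⟩ j ⟨hj0, by linarith⟩)
          (hint j ⟨hj0, by linarith⟩ (j + 1) ⟨by linarith, by linarith⟩)]
        have t1 := trapezoid_le_integral_of_concaveOn hc ha hj0 (by linarith)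
        have t2 := integral_le_trapezoid_add_of_concaveOn hc ha hj0 (by linarith)
        have e : (j : ℝ) + 2 = j + 1 + 1 := by ring
        rw [e] at t2
        constructor <;> linarith
    obtain ⟨k1, k2⟩ := key n le_rfl
    have t1 := trapezoid_le_integral_of_concaveOn hc ha hn0 hfl
    have t2 : ∫ t in (n : ℝ)..(n + 1), g t ≤ g n := by
      have : ∫ t in (n : ℝ)..(n + 1), g t ≤ ∫ t in (n : ℝ)..(n + 1), g n := by
        apply intervalIntegral.integral_mono_on (by linarith)
          (hint _ ⟨hn0, by linarith⟩ _ ⟨by linarith, hfl⟩) (by simp)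
        intro t ht
        exact ha ⟨hn0, by linarith⟩ ⟨hn0.trans ht.1, by linarith [ht.2]⟩ ht.1
      simpa using this
    obtain ⟨t3, t4⟩ := tail (n + 1) ⟨by linarith, hfl⟩ (by linarith)
    have p1 := hpos (n + 1) ⟨by linarith, hfl⟩
    have p2 : g 1 ≤ g 0 := ha ⟨le_rfl, h0⟩ ⟨zero_le_one, by linarith⟩ zero_le_one
    have p3 : g (n + 1) ≤ g n := ha ⟨hn0, by linarith⟩ ⟨by linarith, hfl⟩ (by linarith)
    rw [Finset.sum_Icc_succ_top (by omega)]
    push_cast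
    rw [← intervalIntegral.integral_add_adjacent_intervals
          (hint 0 ⟨le_rfl, h0⟩ n ⟨hn0, by linarith⟩)
          (hint n ⟨hn0, by linarith⟩ a ⟨h0, le_rfl⟩),
      ← intervalIntegral.integral_add_adjacent_intervals
          (hint n ⟨hn0, by linarith⟩ (n + 1) ⟨by linarith, hfl⟩)
          (hint (n + 1) ⟨by linarith, hfl⟩ a ⟨h0, le_rfl⟩)]
    rw [abs_le]
    constructor <;> linarith

/-! ### The sawtooth function -/

/-- The sawtooth function `{u} - 1/2`. -/
noncomputable def sawtooth (u : ℝ) : ℝ := Int.fract u - 1 / 2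

theorem abs_sawtooth_le (u : ℝ) : |sawtooth u| ≤ 1 / 2 := by
  unfold sawtooth
  rw [abs_le]
  constructor <;> linarith [Int.fract_nonneg u, Int.fract_lt_one u]

/-- The floor is monotone, so the sawtooth jumps only downwards and rises with slope one. This
one-sided control permits comparison after a small shift despite the jumps. -/
theorem sawtooth_le_add {u v : ℝ} (h : v ≤ u) : sawtooth u ≤ sawtooth v + (u - v) := by
  unfold sawtooth Int.fract
  have : ((⌊v⌋ : ℤ) : ℝ) ≤ ⌊u⌋ := by exact_mod_cast Int.floor_le_floor h
  linarith

/-- The fractional part of `(m + δ) / q` for an integer `m` and `0 ≤ δ < 1`. -/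
theorem fract_intCast_add_div {q : ℕ} (hq : 0 < q) (m : ℤ) {δ : ℝ} (h0 : 0 ≤ δ) (h1 : δ < 1) :
    Int.fract (((m : ℝ) + δ) / q) = (((m % q : ℤ) : ℝ) + δ) / q := by
  have hq' : (0 : ℝ) < q := by exact_mod_cast hq
  have hz : (0 : ℤ) < q := by exact_mod_cast hq
  rw [Int.fract_eq_iff]
  have b0 : (0 : ℝ) ≤ ((m % q : ℤ) : ℝ) := by exact_mod_cast Int.emod_nonneg m hz.ne'
  have b1 : ((m % q : ℤ) : ℝ) + 1 ≤ q := by exact_mod_cast Int.emod_lt_of_pos m hz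
  refine ⟨by positivity, ?_, m / q, ?_⟩
  · rw [div_lt_one hq']; linarith
  · have : (m : ℝ) = (q : ℝ) * ((m / q : ℤ) : ℝ) + ((m % q : ℤ) : ℝ) := by
      exact_mod_cast (Int.mul_ediv_add_emod m q).symm
    rw [← sub_div]
    rw [this]
    field_simp
    ring

/-- A complete residue system summed through an affine map modulo `q`. -/
theorem sum_emod_affine {q : ℕ} (hq : 0 < q) (s : ℤ) {a : ℤ} (ha : IsCoprime a (q : ℤ)) :
    ∑ j ∈ Finset.range q, ((s + a * j) % (q : ℤ)) = ∑ j ∈ Finset.range q, (j : ℤ) := by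
  have hz : (0 : ℤ) < q := by exact_mod_cast hq
  have hmaps : ∀ j ∈ Finset.range q, ((s + a * j) % (q : ℤ)).toNat ∈ Finset.range q := by
    intro j _
    rw [Finset.mem_range]
    have := Int.emod_lt_of_pos (s + a * j) hz
    have := Int.emod_nonneg (s + a * j) hz.ne'
    omega
  have hinj : Set.InjOn (fun j : ℕ => ((s + a * j) % (q : ℤ)).toNat) (Finset.range q) := by
    intro i hi j hj hij
    simp only [Finset.coe_range, Set.mem_Iio] at hi hj
    have h1 := Int.emod_nonneg (s + a * j) hz.ne'
    have h2 := Int.emod_nonneg (s + a * i) hz.ne'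
    have h3 : (s + a * i) % (q : ℤ) = (s + a * j) % (q : ℤ) := by
      simp only at hij; omega
    have h4 : (q : ℤ) ∣ a * (i - j) := by
      have := (Int.emod_eq_emod_iff_emod_sub_eq_zero).1 h3
      have := Int.dvd_of_emod_eq_zero this
      have e : a * ((i : ℤ) - j) = s + a * i - (s + a * j) := by ring
      rwa [e]
    have h5 : (q : ℤ) ∣ (i - j) := ha.symm.dvd_of_dvd_mul_left h4
    have h6 : ((i : ℤ) - j) = 0 := by
      apply Int.eq_zero_of_abs_lt_dvd h5
      rw [abs_lt]; constructor <;> omega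
    omega
  have himg : (Finset.range q).image (fun j : ℕ => ((s + a * j) % (q : ℤ)).toNat) =
      Finset.range q := by
    apply Finset.eq_of_subset_of_card_le
    · intro x hx
      obtain ⟨j, hj, rfl⟩ := Finset.mem_image.1 hx
      exact hmaps j hj
    · rw [Finset.card_image_of_injOn hinj]
  conv_rhs => rw [← himg]
  rw [Finset.sum_image hinj]
  refine Finset.sum_congr rfl fun j _ => ?_
  rw [Int.toNat_of_nonneg (Int.emod_nonneg _ hz.ne')]

/-- The sawtooth sums to at most `1/2` along a full period of an arithmetic progression whose common
difference is a reduced fraction. -/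
theorem abs_sum_sawtooth_period_le {q : ℕ} (hq : 0 < q) (c : ℝ) {a : ℤ}
    (ha : IsCoprime a (q : ℤ)) :
    |∑ j ∈ Finset.range q, sawtooth (c + a * j / q)| ≤ 1 / 2 := by
  have hq' : (0 : ℝ) < q := by exact_mod_cast hq
  -- Multiplied by `q`, the arguments become `s + a * j + δ`; the integers `s + a * j` run through
  -- all residues modulo `q`, so the sum is exactly `δ - 1 / 2`.
  set s := ⌊(q : ℝ) * c⌋ with hs
  set δ := Int.fract ((q : ℝ) * c) with hδ
  have h0 : 0 ≤ δ := Int.fract_nonneg _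
  have h1 : δ < 1 := Int.fract_lt_one _
  have hc : (q : ℝ) * c = s + δ := (Int.floor_add_fract _).symm
  have hterm : ∀ j ∈ Finset.range q, sawtooth (c + a * j / q) =
      (((s + a * j) % (q : ℤ) : ℤ) : ℝ) / q + (δ / q - 1 / 2) := by
    intro j _
    have e : c + a * j / q = (((s + a * j : ℤ) : ℝ) + δ) / q := by
      push_cast
      field_simp
      linarith
    unfold sawtooth
    rw [e, fract_intCast_add_div hq _ h0 h1]
    ring
  rw [Finset.sum_congr rfl hterm, Finset.sum_add_distrib, ← Finset.sum_div, ← Int.cast_sum,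
    sum_emod_affine hq s ha]
  have hg : (∑ j ∈ Finset.range q, (j : ℝ)) = q * (q - 1) / 2 := by
    clear * -
    induction q with
    | zero => simp
    | succ n ih => rw [Finset.sum_range_succ, ih]; push_cast; ring
  have : ((∑ j ∈ Finset.range q, (j : ℤ) : ℤ) : ℝ) / q + ∑ j ∈ Finset.range q, (δ / q - 1 / 2) =
      δ - 1 / 2 := by
    push_cast
    rw [hg, Finset.sum_const, Finset.card_range, nsmul_eq_mul]
    field_simp
    ring
  rw [this, abs_le]
  constructor <;> linarith

/-- The sawtooth sums to `O(1)` over a block on which the argument is, up to `O(1/q)`, an arithmetic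
progression with common difference `a / q`. -/
theorem abs_sum_sawtooth_block_le {q : ℕ} (hq : 0 < q) {a : ℤ} (ha : IsCoprime a (q : ℤ))
    {c K : ℝ} {h : ℕ → ℝ} (hh : ∀ j < q, |h j - (c + a * j / q)| ≤ K / q) :
    |∑ j ∈ Finset.range q, sawtooth (h j)| ≤ 1 / 2 + 2 * K := by
  have hq' : (0 : ℝ) < q := by exact_mod_cast hq
  have hK : ∑ j ∈ Finset.range q, 2 * (K / q) = 2 * K := by
    rw [Finset.sum_const, Finset.card_range, nsmul_eq_mul]; field_simp
  -- Shifting the progression by `K / q` puts it entirely on one side of `h`, at distance at most `2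
  -- * K / q`; the `q` terms together cost `2 * K`.
  have up : ∑ j ∈ Finset.range q, sawtooth (h j) ≤
      ∑ j ∈ Finset.range q, sawtooth ((c - K / q) + a * j / q) + 2 * K := by
    rw [← hK, ← Finset.sum_add_distrib]
    refine Finset.sum_le_sum fun j hj => ?_
    have := abs_le.1 (hh j (Finset.mem_range.1 hj))
    have := sawtooth_le_add (u := h j) (v := c - K / q + a * j / q) (by linarith [this.1])
    linarith
  have lo : ∑ j ∈ Finset.range q, sawtooth ((c + K / q) + a * j / q) ≤
      ∑ j ∈ Finset.range q, sawtooth (h j) + 2 * K := by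
    rw [← hK, ← Finset.sum_add_distrib]
    refine Finset.sum_le_sum fun j hj => ?_
    have := abs_le.1 (hh j (Finset.mem_range.1 hj))
    have := sawtooth_le_add (u := c + K / q + a * j / q) (v := h j) (by linarith [this.2])
    linarith
  have b1 := abs_le.1 (abs_sum_sawtooth_period_le hq (c - K / q) ha)
  have b2 := abs_le.1 (abs_sum_sawtooth_period_le hq (c + K / q) ha)
  rw [abs_le]
  constructor <;> linarith [b1.2, b2.1]

/-! ### The functions `t ↦ (N ^ k - t ^ k) ^ e` -/

/-- The function `t ↦ (N ^ k - t ^ k) ^ e`. -/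
noncomputable def powProfile (k : ℕ) (N e t : ℝ) : ℝ := (N ^ k - t ^ k) ^ e

section Profile

variable {k : ℕ} {N e : ℝ}

theorem sub_pow_nonneg_of_mem {t : ℝ} (ht : t ∈ Set.Icc 0 N) : 0 ≤ N ^ k - t ^ k :=
  sub_nonneg.2 (pow_le_pow_left₀ ht.1 ht.2 k)

theorem powProfile_nonneg {t : ℝ} (ht : t ∈ Set.Icc 0 N) : 0 ≤ powProfile k N e t :=
  Real.rpow_nonneg (sub_pow_nonneg_of_mem ht) _

theorem continuous_powProfile (he : 0 ≤ e) : Continuous (powProfile k N e) := by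
  unfold powProfile
  exact Continuous.rpow_const (by fun_prop) fun _ => Or.inr he

theorem antitoneOn_powProfile (he : 0 ≤ e) : AntitoneOn (powProfile k N e) (Set.Icc 0 N) := by
  intro s hs t ht hst
  exact Real.rpow_le_rpow (sub_pow_nonneg_of_mem ht)
    (sub_le_sub_left (pow_le_pow_left₀ hs.1 hst k) _) he

/-- A concave increasing power is composed with the concave function `N ^ k - t ^ k`. -/
theorem concaveOn_powProfile (he : 0 ≤ e) (he1 : e ≤ 1) :
    ConcaveOn ℝ (Set.Icc 0 N) (powProfile k N e) := by
  refine ⟨convex_Icc 0 N, ?_⟩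
  intro s hs t ht a b ha hb hab
  have h1 := (Real.concaveOn_rpow he he1).2 (sub_pow_nonneg_of_mem (k := k) hs)
    (sub_pow_nonneg_of_mem (k := k) ht) ha hb hab
  have h2 := (convexOn_pow k).2 (Set.mem_Ici.2 hs.1) (Set.mem_Ici.2 ht.1) ha hb hab
  simp only [smul_eq_mul] at h1 h2 ⊢
  refine h1.trans (Real.rpow_le_rpow ?_ ?_ he)
  · exact add_nonneg (mul_nonneg ha (sub_pow_nonneg_of_mem hs))
      (mul_nonneg hb (sub_pow_nonneg_of_mem ht))
  · have : a * (N ^ k - s ^ k) + b * (N ^ k - t ^ k) = (a + b) * N ^ k - (a * s ^ k + b * t ^ k) := by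
      ring
    rw [this, hab]
    linarith

/-- The upper mean value bound for powers. -/
theorem pow_sub_pow_le_mul {s t : ℝ} (hs : 0 ≤ s) (hst : s ≤ t) (k : ℕ) :
    t ^ k - s ^ k ≤ k * t ^ (k - 1) * (t - s) := by
  have := abs_pow_sub_pow_le t s k
  rw [abs_of_nonneg (sub_nonneg.2 (pow_le_pow_left₀ hs hst k)), abs_of_nonneg (sub_nonneg.2 hst),
    abs_of_nonneg hs, abs_of_nonneg (hs.trans hst), max_eq_left hst] at this
  linarith

theorem mul_le_pow_sub_pow {s t : ℝ} (hs : 0 ≤ s) (hst : s ≤ t) (k : ℕ) :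
    k * s ^ (k - 1) * (t - s) ≤ t ^ k - s ^ k := by
  rw [← Commute.geom_sum₂_mul (Commute.all t s)]
  refine mul_le_mul_of_nonneg_right ?_ (sub_nonneg.2 hst)
  have : ∑ i ∈ Finset.range k, s ^ (k - 1) ≤
      ∑ i ∈ Finset.range k, t ^ i * s ^ (k - 1 - i) := by
    refine Finset.sum_le_sum fun i hi => ?_
    have : i ≤ k - 1 := by have := Finset.mem_range.1 hi; omega
    calc s ^ (k - 1) = s ^ i * s ^ (k - 1 - i) := by rw [← pow_add]; congr 1; omega
      _ ≤ t ^ i * s ^ (k - 1 - i) := by gcongr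
  simpa using this

/-- This is subadditivity of `r ↦ r ^ e` for exponents in `[0, 1]`; it bounds drops of the profile
even near `N`, where its derivative may blow up. -/
theorem powProfile_le_add (he : 0 ≤ e) (he1 : e ≤ 1) {s t : ℝ} (hs : 0 ≤ s) (hst : s ≤ t)
    (ht : t ≤ N) : powProfile k N e s ≤ powProfile k N e t + (t ^ k - s ^ k) ^ e := by
  have h1 : 0 ≤ N ^ k - t ^ k := sub_pow_nonneg_of_mem ⟨hs.trans hst, ht⟩
  have h2 : 0 ≤ t ^ k - s ^ k := sub_pow_nonneg_of_mem ⟨hs, hst⟩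
  have := NNReal.rpow_add_le_add_rpow ⟨_, h1⟩ ⟨_, h2⟩ he he1
  have h3 : (N ^ k - t ^ k + (t ^ k - s ^ k)) ^ e ≤ (N ^ k - t ^ k) ^ e + (t ^ k - s ^ k) ^ e := by
    exact_mod_cast this
  unfold powProfile
  convert h3 using 2
  ring

/-- Euler–Maclaurin summation for `t ↦ (N ^ k - t ^ k) ^ e` on `[0, a]`. -/
theorem abs_sum_powProfile_sub_le (he : 0 ≤ e) (he1 : e ≤ 1) {a : ℝ} (ha : a ∈ Set.Icc 0 N) :
    |∑ m ∈ Finset.Icc 1 ⌊a⌋₊, (powProfile k N e m - powProfile k N e a) -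
      ((∫ t in (0 : ℝ)..a, powProfile k N e t) - a * powProfile k N e a -
        (powProfile k N e 0 - powProfile k N e a) / 2)| ≤ 2 * (2 * k * N ^ (k - 1)) ^ e := by
  have hsub : Set.Icc 0 a ⊆ Set.Icc 0 N := Set.Icc_subset_Icc le_rfl ha.2
  -- Subtracting the value at `a` turns the Euler–Maclaurin error into a drop of the profile over a
  -- length at most `2`.
  have h := abs_sum_sub_integral_le_of_concaveOn
    (g := fun t => powProfile k N e t - powProfile k N e a) ha.1
    (((concaveOn_powProfile he he1).subset hsub (convex_Icc 0 a)).sub (convexOn_const _ (convex_Icc 0 a)))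
    (fun s hs t ht hst => sub_le_sub_right (antitoneOn_powProfile he (hsub hs) (hsub ht) hst) _)
    (by simp)
  rw [intervalIntegral.integral_sub ((continuous_powProfile he).intervalIntegrable _ _) (by simp),
    intervalIntegral.integral_const, sub_zero, smul_eq_mul] at h
  refine h.trans ?_
  have hm : (((⌊a⌋₊ - 1 : ℕ) : ℕ) : ℝ) ≤ a :=
    (Nat.cast_le.2 (Nat.sub_le _ _)).trans (Nat.floor_le ha.1)
  have hm2 : a - ((⌊a⌋₊ - 1 : ℕ) : ℝ) ≤ 2 := by
    have h1 := Nat.lt_floor_add_one a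
    have h2 : (⌊a⌋₊ : ℝ) ≤ ((⌊a⌋₊ - 1 : ℕ) : ℝ) + 1 := by exact_mod_cast (by omega)
    linarith
  have hm0 : (0 : ℝ) ≤ ((⌊a⌋₊ - 1 : ℕ) : ℝ) := Nat.cast_nonneg _
  have h1 := powProfile_le_add (k := k) (N := N) he he1 hm0 hm ha.2
  have h2 : (a ^ k - ((⌊a⌋₊ - 1 : ℕ) : ℝ) ^ k) ^ e ≤ (2 * k * N ^ (k - 1)) ^ e := by
    apply Real.rpow_le_rpow (sub_pow_nonneg_of_mem ⟨hm0, hm⟩) _ he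
    refine (pow_sub_pow_le_mul hm0 hm k).trans ?_
    calc k * a ^ (k - 1) * (a - ((⌊a⌋₊ - 1 : ℕ) : ℝ)) ≤ k * N ^ (k - 1) * 2 := by
          have := ha.1
          gcongr
          · exact mul_nonneg (Nat.cast_nonneg _) (pow_nonneg (ha.1.trans ha.2) _)
          · exact ha.2
      _ = 2 * k * N ^ (k - 1) := by ring
  linarith

theorem powProfile_zero (hk : k ≠ 0) (hN : 0 ≤ N) : powProfile k N e 0 = N ^ (k * e) := by
  unfold powProfile
  rw [zero_pow hk, sub_zero, ← Real.rpow_natCast, ← Real.rpow_mul hN]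

/-- The point `(t, (N ^ k - t ^ k) ^ (1 / k))` lies on the curve `x ^ k + y ^ k = N ^ k`. -/
theorem powProfile_pow (hk : k ≠ 0) {t : ℝ} (ht : t ∈ Set.Icc 0 N) :
    powProfile k N (1 / k) t ^ k = N ^ k - t ^ k := by
  unfold powProfile
  rw [one_div]
  exact Real.rpow_inv_natCast_pow (sub_pow_nonneg_of_mem ht) hk

theorem powProfile_mem (hk : k ≠ 0) {t : ℝ} (ht : t ∈ Set.Icc 0 N) :
    powProfile k N (1 / k) t ∈ Set.Icc 0 N := by
  have h0 := powProfile_nonneg (k := k) (e := 1 / k) ht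
  refine ⟨h0, ?_⟩
  apply le_of_pow_le_pow_left₀ hk (ht.1.trans ht.2)
  rw [powProfile_pow hk ht]
  linarith [pow_nonneg ht.1 k]

/-- The equation of the curve is symmetric in its coordinates, so the height function is an
involution; the reciprocity rests on this. -/
theorem powProfile_powProfile (hk : k ≠ 0) {t : ℝ} (ht : t ∈ Set.Icc 0 N) :
    powProfile k N (1 / k) (powProfile k N (1 / k) t) = t := by
  have h := powProfile_pow hk (powProfile_mem hk ht)
  rw [powProfile_pow hk ht] at h
  apply (pow_left_inj₀ (powProfile_mem hk (powProfile_mem hk ht)).1 ht.1 hk).1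
  linarith

theorem powProfile_zero' (hk : k ≠ 0) (hN : 0 ≤ N) : powProfile k N (1 / k) 0 = N := by
  have : (k : ℝ) ≠ 0 := by exact_mod_cast hk
  rw [powProfile_zero hk hN, mul_one_div_cancel this, Real.rpow_one]

/-- Area identity for the region bounded by the axes and the curve `x ^ k + y ^ k = N ^ k`. -/
theorem integral_powProfile_add_integral (hk : k ≠ 0) {a : ℝ} (ha : a ∈ Set.Icc 0 N) :
    (∫ t in (0 : ℝ)..a, powProfile k N (1 / k) t) +
      (∫ t in (0 : ℝ)..powProfile k N (1 / k) a, powProfile k N (1 / k) t) -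
      a * powProfile k N (1 / k) a = ∫ t in (0 : ℝ)..N, powProfile k N (1 / k) t := by
  set F := powProfile k N (1 / k) with hF
  have hN : 0 ≤ N := ha.1.trans ha.2
  have hcont : Continuous F := continuous_powProfile (by positivity)
  set G : ℝ → ℝ := fun u => (∫ t in (0 : ℝ)..u, F t) with hG
  have hGd : ∀ u, HasDerivAt G (F u) u := fun u =>
    intervalIntegral.integral_hasDerivAt_right (hcont.intervalIntegrable _ _)
      hcont.aestronglyMeasurable.stronglyMeasurableAtFilter hcont.continuousAt
  have hGc : Continuous G := continuous_iff_continuousAt.2 fun u => (hGd u).continuousAt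
  -- By the involution the derivative `F u + u * F' u - (F u + u * F' u)` vanishes. It is taken only
  -- in the interior, and continuity carries constancy of `H` to the endpoints.
  set H : ℝ → ℝ := fun u => G u + G (F u) - u * F u with hH
  have hHc : Continuous H := by fun_prop
  have hder : ∀ u ∈ interior (Set.Icc 0 N), HasDerivAt H 0 u := by
    intro u hu
    rw [interior_Icc] at hu
    have hu' : u ∈ Set.Icc 0 N := ⟨hu.1.le, hu.2.le⟩
    have hpos : N ^ k - u ^ k ≠ 0 := (sub_pos.2 (pow_lt_pow_left₀ hu.2 hu.1.le hk)).ne'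
    have hd : DifferentiableAt ℝ F u := by
      rw [hF]; unfold powProfile
      exact DifferentiableAt.rpow_const (by fun_prop) (Or.inl hpos)
    have hd' := hd.hasDerivAt
    have h := ((hGd u).add ((hGd (F u)).comp u hd')).sub ((hasDerivAt_id u).mul hd')
    have hFF : F (F u) = u := powProfile_powProfile hk hu'
    have hz : F u + F (F u) * deriv F u - (1 * F u + id u * deriv F u) = 0 := by
      rw [hFF, id]; ring
    rw [hz] at h
    exact h
  have hdiff : DifferentiableOn ℝ H (interior (Set.Icc 0 N)) := fun u hu =>
    (hder u hu).differentiableAt.differentiableWithinAt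
  have hmono : MonotoneOn H (Set.Icc 0 N) := monotoneOn_of_deriv_nonneg (convex_Icc 0 N)
    hHc.continuousOn hdiff fun u hu => (hder u hu).deriv.ge
  have hanti : AntitoneOn H (Set.Icc 0 N) := antitoneOn_of_deriv_nonpos (convex_Icc 0 N)
    hHc.continuousOn hdiff fun u hu => (hder u hu).deriv.le
  have h0 : (0 : ℝ) ∈ Set.Icc 0 N := ⟨le_rfl, hN⟩
  have e1 : H a = H 0 := le_antisymm (hanti h0 ha ha.1) (hmono h0 ha ha.1)
  have e2 : H 0 = G N := by
    simp only [hH]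
    rw [hF, powProfile_zero' hk hN]
    simp [hG]
  exact e1.trans e2

/-- Scaling of the integral over the full range. -/
theorem integral_powProfile (hN : 0 < N) :
    ∫ t in (0 : ℝ)..N, powProfile k N e t =
      N ^ (k * e + 1) * ∫ t in (0 : ℝ)..1, powProfile k 1 e t := by
  have h := intervalIntegral.mul_integral_comp_mul_left (f := powProfile k N e) (a := 0) (b := 1) N
  rw [mul_zero, mul_one] at h
  rw [← h, Real.rpow_add hN, Real.rpow_one, mul_comm _ N, mul_assoc]
  congr 1
  rw [← intervalIntegral.integral_const_mul]
  apply intervalIntegral.integral_congr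
  intro t ht
  rw [Set.uIcc_of_le zero_le_one] at ht
  simp only [powProfile]
  rw [Real.rpow_mul hN.le, Real.rpow_natCast, ← Real.mul_rpow (by positivity)
    (sub_pow_nonneg_of_mem ht)]
  congr 1
  ring

/-- The integral of `(1 - t ^ k) ^ e` as a quotient of Gamma values. -/
theorem integral_powProfile_one (hk : k ≠ 0) (he : 0 ≤ e) :
    ∫ t in (0 : ℝ)..1, powProfile k 1 e t =
      Real.Gamma (1 + 1 / k) * Real.Gamma (1 + e) / Real.Gamma (1 + e + 1 / k) := by
  have hk0 : (0 : ℝ) < k := by exact_mod_cast Nat.pos_of_ne_zero hk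
  have hbeta := ProbabilityTheory.beta_eq_betaIntegralReal (1 / k) (1 + e) (by positivity)
    (by positivity)
  have hre : (Complex.betaIntegral ((1 / k : ℝ) : ℂ) ((1 + e : ℝ) : ℂ)).re =
      ∫ x in (0 : ℝ)..1, x ^ (1 / (k : ℝ) - 1) * (1 - x) ^ e := by
    unfold Complex.betaIntegral
    have : (∫ x in (0 : ℝ)..1, (x : ℂ) ^ (((1 / k : ℝ) : ℂ) - 1) *
        (1 - (x : ℂ)) ^ (((1 + e : ℝ) : ℂ) - 1)) =
        ∫ x in (0 : ℝ)..1, ((x ^ (1 / (k : ℝ) - 1) * (1 - x) ^ e : ℝ) : ℂ) := by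
      apply intervalIntegral.integral_congr
      intro x hx
      rw [Set.uIcc_of_le zero_le_one] at hx
      simp only
      rw [Complex.ofReal_mul, Complex.ofReal_cpow hx.1, Complex.ofReal_cpow (by linarith [hx.2])]
      push_cast
      ring_nf
    rw [this, intervalIntegral.integral_ofReal, Complex.ofReal_re]
  -- Substitution `x = t ^ k` in the Beta integral; the indicator adapts the change of variables on
  -- the half-line to `[0, 1]`.
  have hsub : ∫ x in (0 : ℝ)..1, x ^ (1 / (k : ℝ) - 1) * (1 - x) ^ e =
      k * ∫ t in (0 : ℝ)..1, powProfile k 1 e t := by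
    rw [intervalIntegral.integral_of_le zero_le_one, intervalIntegral.integral_of_le zero_le_one,
      ← MeasureTheory.integral_const_mul]
    have h := MeasureTheory.integral_comp_rpow_Ioi_of_pos
      (g := (Set.Iic (1 : ℝ)).indicator fun x => x ^ (1 / (k : ℝ) - 1) * (1 - x) ^ e) hk0
    have l : ∫ y in Set.Ioi (0 : ℝ), (Set.Iic (1 : ℝ)).indicator
        (fun x => x ^ (1 / (k : ℝ) - 1) * (1 - x) ^ e) y =
        ∫ x in Set.Ioc (0 : ℝ) 1, x ^ (1 / (k : ℝ) - 1) * (1 - x) ^ e := by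
      rw [MeasureTheory.setIntegral_indicator measurableSet_Iic, Set.Ioi_inter_Iic]
    have r : ∫ x in Set.Ioi (0 : ℝ), (k * x ^ ((k : ℝ) - 1)) • (Set.Iic (1 : ℝ)).indicator
        (fun x => x ^ (1 / (k : ℝ) - 1) * (1 - x) ^ e) (x ^ (k : ℝ)) =
        ∫ x in Set.Ioc (0 : ℝ) 1, k * powProfile k 1 e x := by
      rw [← Set.Ioi_inter_Iic, ← MeasureTheory.setIntegral_indicator measurableSet_Iic]
      apply MeasureTheory.setIntegral_congr_fun measurableSet_Ioi
      intro x hx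
      have hx0 : (0 : ℝ) < x := hx
      simp only [smul_eq_mul]
      by_cases h1 : x ≤ 1
      · rw [Set.indicator_of_mem (Set.mem_Iic.2 (Real.rpow_le_one hx0.le h1 hk0.le)),
          Set.indicator_of_mem (Set.mem_Iic.2 h1)]
        unfold powProfile
        rw [← Real.rpow_mul hx0.le, Real.rpow_natCast, one_pow, ← mul_assoc, mul_assoc (k : ℝ),
          ← Real.rpow_add hx0]
        have : (k : ℝ) - 1 + k * (1 / k - 1) = 0 := by field_simp; ring
        rw [this, Real.rpow_zero, mul_one]
      · rw [Set.indicator_of_notMem (fun h => h1 ?_), Set.indicator_of_notMem (show x ∉ Set.Iic 1 from h1),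
          mul_zero]
        by_contra hlt
        exact absurd (Set.mem_Iic.1 h) (not_le.2 (Real.one_lt_rpow (not_le.1 hlt) hk0))
    rw [l, r] at h
    exact h.symm
  rw [hre, hsub] at hbeta
  unfold ProbabilityTheory.beta at hbeta
  have hG : Real.Gamma (1 + 1 / k) = 1 / k * Real.Gamma (1 / k) := by
    rw [add_comm, Real.Gamma_add_one (by positivity)]
  rw [hG]
  have e1 : 1 / (k : ℝ) + (1 + e) = 1 + e + 1 / k := by ring
  rw [e1] at hbeta
  have : (∫ t in (0 : ℝ)..1, powProfile k 1 e t) =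
      1 / k * (k * ∫ t in (0 : ℝ)..1, powProfile k 1 e t) := by field_simp
  rw [this, ← hbeta]
  ring

end Profile

/-! ### Reciprocity for sawtooth sums along the curve `x ^ k + y ^ k = N ^ k` -/

section Reciprocity

variable {k : ℕ} {N : ℝ}

theorem le_powProfile_comm (hk : k ≠ 0) {u v : ℝ} (hu : u ∈ Set.Icc 0 N) (hv : v ∈ Set.Icc 0 N)
    (h : u ≤ powProfile k N (1 / k) v) : v ≤ powProfile k N (1 / k) u := by
  rw [← powProfile_powProfile hk hv]
  exact antitoneOn_powProfile (by positivity) hu (powProfile_mem hk hv) h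

/-- Lattice points under the curve, counted by columns up to `a` and by rows up to the height of the
curve at `a`. -/
theorem sum_floor_powProfile_reciprocity (hk : k ≠ 0) {a : ℝ} (ha : a ∈ Set.Icc 0 N) :
    ∑ m ∈ Finset.Icc 1 ⌊N⌋₊, ⌊powProfile k N (1 / k) m⌋₊ +
        ⌊a⌋₊ * ⌊powProfile k N (1 / k) a⌋₊ =
      ∑ m ∈ Finset.Icc 1 ⌊a⌋₊, ⌊powProfile k N (1 / k) m⌋₊ +
        ∑ m ∈ Finset.Icc 1 ⌊powProfile k N (1 / k) a⌋₊, ⌊powProfile k N (1 / k) m⌋₊ := by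
  set F := powProfile k N (1 / k) with hF
  have hN : 0 ≤ N := ha.1.trans ha.2
  have hle : ⌊a⌋₊ ≤ ⌊N⌋₊ := Nat.floor_le_floor ha.2
  have hb := powProfile_mem hk ha
  have hbN : ⌊F a⌋₊ ≤ ⌊N⌋₊ := Nat.floor_le_floor hb.2
  have hmem : ∀ m : ℕ, m ≤ ⌊N⌋₊ → (m : ℝ) ∈ Set.Icc 0 N := fun m hm =>
    ⟨Nat.cast_nonneg _, (Nat.cast_le.2 hm).trans (Nat.floor_le hN)⟩
  have hanti : AntitoneOn F (Set.Icc 0 N) := antitoneOn_powProfile (by positivity)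
  have hsplit : ∑ m ∈ Finset.Icc 1 ⌊N⌋₊, ⌊F m⌋₊ =
      ∑ m ∈ Finset.Icc 1 ⌊a⌋₊, ⌊F m⌋₊ + ∑ m ∈ Finset.Ioc ⌊a⌋₊ ⌊N⌋₊, ⌊F m⌋₊ := by
    rw [← Finset.sum_union]
    · congr 1
      ext m
      simp only [Finset.mem_union, Finset.mem_Icc, Finset.mem_Ioc]
      omega
    · rw [Finset.disjoint_left]
      intro m h1 h2
      have := (Finset.mem_Icc.1 h1).2
      have := (Finset.mem_Ioc.1 h2).1
      omega
  have hcol : ∀ m ∈ Finset.Ioc ⌊a⌋₊ ⌊N⌋₊,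
      ⌊F m⌋₊ = ((Finset.Icc 1 ⌊F a⌋₊).bipartiteAbove (fun (m y : ℕ) => (y : ℝ) ≤ F m) m).card := by
    intro m hm
    rw [Finset.mem_Ioc] at hm
    have hm' := hmem m hm.2
    have hFm : 0 ≤ F m := (powProfile_mem hk hm').1
    have ham : a ≤ m := (Nat.lt_of_floor_lt hm.1).le
    have hFa : ⌊F m⌋₊ ≤ ⌊F a⌋₊ := Nat.floor_le_floor (hanti ha hm' ham)
    have : (Finset.Icc 1 ⌊F a⌋₊).bipartiteAbove (fun (m y : ℕ) => (y : ℝ) ≤ F m) m =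
        Finset.Icc 1 ⌊F m⌋₊ := by
      ext y
      rw [Finset.mem_bipartiteAbove, Finset.mem_Icc, Finset.mem_Icc, ← Nat.le_floor_iff hFm]
      omega
    rw [this, Nat.card_Icc, Nat.add_sub_cancel]
  -- A row at height `y ≤ F a` reaches past `a`: its first `⌊a⌋₊` points form the overlap rectangle,
  -- and the others are those counted in the columns beyond `a`.
  have hrow : ∀ y ∈ Finset.Icc 1 ⌊F a⌋₊, ⌊F y⌋₊ =
      ((Finset.Ioc ⌊a⌋₊ ⌊N⌋₊).bipartiteBelow (fun (m y : ℕ) => (y : ℝ) ≤ F m) y).card + ⌊a⌋₊ := by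
    intro y hy
    rw [Finset.mem_Icc] at hy
    have hy' := hmem y (hy.2.trans hbN)
    have hFy := powProfile_mem hk hy'
    have hya : (y : ℝ) ≤ F a := (Nat.cast_le.2 hy.2).trans (Nat.floor_le hb.1)
    have hay : a ≤ F y := le_powProfile_comm hk hy' ha hya
    have h1 : ⌊a⌋₊ ≤ ⌊F y⌋₊ := Nat.floor_le_floor hay
    have h2 : ⌊F y⌋₊ ≤ ⌊N⌋₊ := Nat.floor_le_floor hFy.2
    have : (Finset.Ioc ⌊a⌋₊ ⌊N⌋₊).bipartiteBelow (fun (m y : ℕ) => (y : ℝ) ≤ F m) y =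
        Finset.Ioc ⌊a⌋₊ ⌊F y⌋₊ := by
      ext m
      rw [Finset.mem_bipartiteBelow, Finset.mem_Ioc, Finset.mem_Ioc, Nat.le_floor_iff hFy.1]
      constructor
      · rintro ⟨⟨h3, h4⟩, h5⟩
        exact ⟨h3, le_powProfile_comm hk hy' (hmem m h4) h5⟩
      · rintro ⟨h3, h4⟩
        have hm : m ≤ ⌊N⌋₊ := (Nat.le_floor h4).trans h2
        exact ⟨⟨h3, hm⟩, le_powProfile_comm hk (hmem m hm) hy' h4⟩
    rw [this, Nat.card_Ioc]
    omega
  rw [hsplit, Finset.sum_congr rfl hcol,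
    Finset.sum_card_bipartiteAbove_eq_sum_card_bipartiteBelow, Finset.sum_congr rfl hrow,
    Finset.sum_add_distrib, Finset.sum_const, Nat.card_Icc, Nat.add_sub_cancel, smul_eq_mul]
  ring

/-- The sum of the sawtooth function over the heights of the curve `x ^ k + y ^ k = N ^ k` at the
positive integers up to `a`. -/
noncomputable def curveSawtoothSum (k : ℕ) (N a : ℝ) : ℝ :=
  ∑ m ∈ Finset.Icc 1 ⌊a⌋₊, sawtooth (powProfile k N (1 / k) m)

theorem curveSawtoothSum_eq (hk : k ≠ 0) {a : ℝ} (ha : a ∈ Set.Icc 0 N) :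
    curveSawtoothSum k N a = ∑ m ∈ Finset.Icc 1 ⌊a⌋₊, powProfile k N (1 / k) m -
      ((∑ m ∈ Finset.Icc 1 ⌊a⌋₊, ⌊powProfile k N (1 / k) m⌋₊ : ℕ) : ℝ) - ⌊a⌋₊ / 2 := by
  have : ∀ m ∈ Finset.Icc 1 ⌊a⌋₊, sawtooth (powProfile k N (1 / k) m) =
      powProfile k N (1 / k) m - (⌊powProfile k N (1 / k) m⌋₊ : ℝ) - 1 / 2 := by
    intro m hm
    have hm : (m : ℝ) ∈ Set.Icc 0 N := ⟨Nat.cast_nonneg _,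
      ((Nat.cast_le.2 (Finset.mem_Icc.1 hm).2).trans (Nat.floor_le ha.1)).trans ha.2⟩
    rw [natCast_floor_eq_intCast_floor (powProfile_mem hk hm).1]
    rfl
  unfold curveSawtoothSum
  rw [Finset.sum_congr rfl this, Finset.sum_sub_distrib, Finset.sum_sub_distrib, Finset.sum_const,
    Nat.card_Icc, Nat.add_sub_cancel, nsmul_eq_mul]
  push_cast
  ring

theorem abs_curveSawtoothSum_sub_le {a b : ℝ} (ha : 0 ≤ a) (hab : a ≤ b) :
    |curveSawtoothSum k N b - curveSawtoothSum k N a| ≤ b - a + 1 := by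
  have hle : ⌊a⌋₊ ≤ ⌊b⌋₊ := Nat.floor_le_floor hab
  have : curveSawtoothSum k N b - curveSawtoothSum k N a =
      ∑ m ∈ Finset.Ioc ⌊a⌋₊ ⌊b⌋₊, sawtooth (powProfile k N (1 / k) m) := by
    unfold curveSawtoothSum
    rw [sub_eq_iff_eq_add', ← Finset.sum_union]
    · congr 1
      ext m
      simp only [Finset.mem_union, Finset.mem_Icc, Finset.mem_Ioc]
      omega
    · rw [Finset.disjoint_left]
      intro m h1 h2
      have := (Finset.mem_Icc.1 h1).2
      have := (Finset.mem_Ioc.1 h2).1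
      omega
  rw [this]
  refine (Finset.abs_sum_le_sum_abs _ _).trans ?_
  refine (Finset.sum_le_card_nsmul _ _ 1 fun m _ =>
    (abs_sawtooth_le _).trans (by norm_num)).trans ?_
  rw [Nat.card_Ioc, nsmul_eq_mul, mul_one, Nat.cast_sub hle]
  linarith [Nat.floor_le (ha.trans hab), Nat.lt_floor_add_one a]

/-- Floor sums cancel by the lattice reciprocity and integrals by the area identity. Three
Euler–Maclaurin errors give the factor `6`; what remains is a product and half-sums of fractional
parts, at most `2`. -/
theorem abs_curveSawtoothSum_reciprocity (hk : k ≠ 0) {a : ℝ} (ha : a ∈ Set.Icc 0 N) :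
    |curveSawtoothSum k N N - curveSawtoothSum k N a -
      curveSawtoothSum k N (powProfile k N (1 / k) a)| ≤
      6 * (2 * k * N ^ (k - 1)) ^ (1 / (k : ℝ)) + 2 := by
  have hN : 0 ≤ N := ha.1.trans ha.2
  have hk1 : (1 : ℝ) ≤ k := by exact_mod_cast Nat.one_le_iff_ne_zero.2 hk
  have hNN : N ∈ Set.Icc 0 N := ⟨hN, le_rfl⟩
  have hb := powProfile_mem hk ha
  have he : (0 : ℝ) ≤ 1 / k := by positivity
  have he1 : (1 : ℝ) / k ≤ 1 := by rw [div_le_one (by linarith)]; exact hk1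
  have hfl : (((∑ m ∈ Finset.Icc 1 ⌊N⌋₊, ⌊powProfile k N (1 / k) m⌋₊ +
        ⌊a⌋₊ * ⌊powProfile k N (1 / k) a⌋₊ : ℕ) : ℕ) : ℝ) = _ :=
    congrArg Nat.cast (sum_floor_powProfile_reciprocity hk ha)
  have area := integral_powProfile_add_integral hk ha
  have s1 := abs_sum_powProfile_sub_le (k := k) he he1 hNN
  have s2 := abs_sum_powProfile_sub_le (k := k) he he1 ha
  have s3 := abs_sum_powProfile_sub_le (k := k) he he1 hb
  have hFN : powProfile k N (1 / k) N = 0 := by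
    have := powProfile_powProfile hk (t := 0) ⟨le_rfl, hN⟩
    rwa [powProfile_zero' hk hN] at this
  rw [curveSawtoothSum_eq hk hNN, curveSawtoothSum_eq hk ha, curveSawtoothSum_eq hk hb]
  rw [powProfile_powProfile hk ha] at s3
  rw [powProfile_zero' hk hN] at s1 s2 s3
  rw [hFN] at s1
  simp only [Finset.sum_sub_distrib, Finset.sum_const, Nat.card_Icc, Nat.add_sub_cancel,
    nsmul_eq_mul] at s1 s2 s3
  rw [Nat.cast_add, Nat.cast_add, Nat.cast_mul] at hfl
  set b := powProfile k N (1 / k) a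
  have f1 := Nat.floor_le ha.1
  have f2 := Nat.lt_floor_add_one a
  have f3 := Nat.floor_le hb.1
  have f4 := Nat.lt_floor_add_one b
  have f5 := Nat.floor_le hN
  have f6 := Nat.lt_floor_add_one N
  -- The rectangle terms `a * b`, `⌊a⌋₊ * b`, `a * ⌊b⌋₊` and `⌊a⌋₊ * ⌊b⌋₊` recombine into this
  -- product.
  have p1 : 0 ≤ (a - ⌊a⌋₊) * (b - ⌊b⌋₊) := mul_nonneg (by linarith) (by linarith)
  have p2 : (a - ⌊a⌋₊) * (b - ⌊b⌋₊) ≤ 1 :=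
    mul_le_one₀ (by linarith) (by linarith) (by linarith)
  rw [abs_le] at s1 s2 s3 ⊢
  constructor <;> linarith [s1.1, s1.2, s2.1, s2.2, s3.1, s3.2]

end Reciprocity

/-! ### The slope of the curve `x ^ k + y ^ k = N ^ k` -/

/-- Minus the slope at `t` of the curve `x ^ k + y ^ k = N ^ k`. -/
noncomputable def curveSlope (k : ℕ) (N t : ℝ) : ℝ := (t / powProfile k N (1 / k) t) ^ (k - 1)

section Slope

variable {k : ℕ} {N D : ℝ}

/-- Chord slopes lie between the tangent slopes at the endpoints. -/
theorem powProfile_sub_mem (hk : k ≠ 0) {s t : ℝ} (hs : 0 ≤ s) (hst : s ≤ t) (ht : t < N) :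
    curveSlope k N s * (t - s) ≤ powProfile k N (1 / k) s - powProfile k N (1 / k) t ∧
      powProfile k N (1 / k) s - powProfile k N (1 / k) t ≤ curveSlope k N t * (t - s) := by
  have hs' : s ∈ Set.Icc 0 N := ⟨hs, (hst.trans_lt ht).le⟩
  have ht' : t ∈ Set.Icc 0 N := ⟨hs.trans hst, ht.le⟩
  have hFst : powProfile k N (1 / k) t ≤ powProfile k N (1 / k) s :=
    antitoneOn_powProfile (by positivity) hs' ht' hst
  have hFt : 0 < powProfile k N (1 / k) t := by
    apply Real.rpow_pos_of_pos
    exact sub_pos.2 (pow_lt_pow_left₀ ht ht'.1 hk)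
  have hFs : 0 < powProfile k N (1 / k) s := hFt.trans_le hFst
  have e1 := powProfile_pow hk hs'
  have e2 := powProfile_pow hk ht'
  -- Both chord bounds come from `F(s) ^ k - F(t) ^ k = t ^ k - s ^ k`, with the mean value bounds
  -- for powers applied to each side.
  have u1 := pow_sub_pow_le_mul hs hst k
  have u2 := mul_le_pow_sub_pow hs hst k
  have u3 := pow_sub_pow_le_mul hFt.le hFst k
  have u4 := mul_le_pow_sub_pow hFt.le hFst k
  have hk0 : (0 : ℝ) < k := by exact_mod_cast Nat.pos_of_ne_zero hk
  unfold curveSlope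
  rw [div_pow, div_pow]
  constructor
  · rw [div_mul_eq_mul_div, div_le_iff₀ (by positivity)]
    have : k * (s ^ (k - 1) * (t - s)) ≤
        k * ((powProfile k N (1 / k) s - powProfile k N (1 / k) t) *
          powProfile k N (1 / k) s ^ (k - 1)) := by linarith
    exact le_of_mul_le_mul_left this hk0
  · rw [div_mul_eq_mul_div, le_div_iff₀ (by positivity)]
    have : k * ((powProfile k N (1 / k) s - powProfile k N (1 / k) t) *
          powProfile k N (1 / k) t ^ (k - 1)) ≤ k * (t ^ (k - 1) * (t - s)) := by linarith
    exact le_of_mul_le_mul_left this hk0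

/-- The relation `2 * D ^ k = N ^ k` puts `(D, D)` on the curve. To its left the heights stay away
from `0`, so slopes remain controlled. -/
theorem le_powProfile_of_le_diag (hk : k ≠ 0) (hD : 0 < D) (hDN : 2 * D ^ k = N ^ k) (hN : 0 < N)
    {t : ℝ} (ht : t ∈ Set.Icc 0 D) : D ≤ powProfile k N (1 / k) t ∧ D < N := by
  have hlt : D < N := by
    apply lt_of_pow_lt_pow_left₀ k hN.le
    linarith [pow_pos hD k]
  refine ⟨?_, hlt⟩
  have ht' : t ∈ Set.Icc 0 N := ⟨ht.1, ht.2.trans hlt.le⟩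
  apply le_of_pow_le_pow_left₀ hk (powProfile_nonneg ht')
  rw [powProfile_pow hk ht']
  linarith [pow_le_pow_left₀ ht.1 ht.2 k]

theorem le_two_mul_diag (hk : k ≠ 0) (hD : 0 < D) (hDN : 2 * D ^ k = N ^ k) : N ≤ 2 * D := by
  apply le_of_pow_le_pow_left₀ hk (by positivity)
  rw [mul_pow, ← hDN]
  gcongr
  exact le_self_pow₀ (by norm_num) hk

theorem curveSlope_le_one (hk : k ≠ 0) (hD : 0 < D) (hDN : 2 * D ^ k = N ^ k) (hN : 0 < N)
    {t : ℝ} (ht : t ∈ Set.Icc 0 D) : curveSlope k N t ≤ 1 := by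
  have h := (le_powProfile_of_le_diag hk hD hDN hN ht).1
  apply pow_le_one₀ (div_nonneg ht.1 (hD.le.trans h))
  rw [div_le_one (hD.trans_le h)]
  exact ht.2.trans h

theorem pow_div_le_curveSlope (hk : k ≠ 0) (hD : 0 < D) (hDN : 2 * D ^ k = N ^ k) (hN : 0 < N)
    {t : ℝ} (ht : t ∈ Set.Icc 0 D) : (t / N) ^ (k - 1) ≤ curveSlope k N t := by
  obtain ⟨h, h2⟩ := le_powProfile_of_le_diag hk hD hDN hN ht
  have h3 := powProfile_mem (N := N) hk (t := t) ⟨ht.1, ht.2.trans h2.le⟩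
  have := ht.1
  unfold curveSlope
  gcongr
  · exact hD.trans_le h
  · exact h3.2

/-- The slope grows at least linearly through the origin. -/
theorem curveSlope_mul_le (hk : 2 ≤ k) (hD : 0 < D) (hDN : 2 * D ^ k = N ^ k) (hN : 0 < N)
    {s t : ℝ} (hs : 0 ≤ s) (hst : s ≤ t) (ht : t ≤ D) :
    curveSlope k N s * t ≤ curveSlope k N t * s := by
  have hk0 : k ≠ 0 := by omega
  obtain ⟨h1, h2⟩ := le_powProfile_of_le_diag hk0 hD hDN hN (t := t) ⟨hs.trans hst, ht⟩
  have hF : powProfile k N (1 / k) t ≤ powProfile k N (1 / k) s :=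
    antitoneOn_powProfile (by positivity) ⟨hs, by linarith⟩ ⟨by linarith, by linarith⟩ hst
  obtain ⟨j, hj⟩ : ∃ j, k - 1 = j + 1 := ⟨k - 2, by omega⟩
  unfold curveSlope
  rw [hj, div_pow, div_pow]
  have hFt := hD.trans_le h1
  have e1 : s ^ (j + 1) / powProfile k N (1 / k) s ^ (j + 1) * t =
      (s * t) * (s ^ j / powProfile k N (1 / k) s ^ (j + 1)) := by rw [pow_succ s]; ring
  have e2 : t ^ (j + 1) / powProfile k N (1 / k) t ^ (j + 1) * s =
      (s * t) * (t ^ j / powProfile k N (1 / k) t ^ (j + 1)) := by rw [pow_succ t]; ring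
  rw [e1, e2]
  have := hs.trans hst
  gcongr

/-- The slope is Lipschitz up to the diagonal. -/
theorem curveSlope_sub_le (hk : k ≠ 0) (hD : 0 < D) (hDN : 2 * D ^ k = N ^ k) (hN : 0 < N)
    {s t : ℝ} (hs : 0 ≤ s) (hst : s ≤ t) (ht : t ≤ D) :
    curveSlope k N t - curveSlope k N s ≤ 4 * k * (t - s) / N := by
  obtain ⟨h1, h2⟩ := le_powProfile_of_le_diag hk hD hDN hN (t := t) ⟨hs.trans hst, ht⟩
  have hFs := (le_powProfile_of_le_diag hk hD hDN hN (t := s) ⟨hs, hst.trans ht⟩).1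
  have hF : powProfile k N (1 / k) t ≤ powProfile k N (1 / k) s :=
    antitoneOn_powProfile (by positivity) ⟨hs, by linarith⟩ ⟨by linarith, by linarith⟩ hst
  have hchord := (powProfile_sub_mem hk hs hst (ht.trans_lt h2)).2
  have hone := curveSlope_le_one hk hD hDN hN (t := t) ⟨hs.trans hst, ht⟩
  have h2D := le_two_mul_diag hk hD hDN
  set y := powProfile k N (1 / k) t
  set z := powProfile k N (1 / k) s
  have hy := hD.trans_le h1
  have hz := hD.trans_le hFs
  have hzy : z - y ≤ t - s := hchord.trans (mul_le_of_le_one_left (sub_nonneg.2 hst) hone)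
  have hw : s / z ≤ t / y := by have := hs.trans hst; gcongr
  have hw1 : t / y ≤ 1 := (div_le_one hy).2 (ht.trans h1)
  -- The change splits into that of the numerator and that of the denominator; each is at most `(t -
  -- s) / y`, and `y ≥ D ≥ N / 2`.
  have hdiff : t / y - s / z ≤ 4 * (t - s) / N := by
    have e : t / y - s / z = (t - s) / y + (s / z) * ((z - y) / y) := by field_simp; ring
    have b1 : (t - s) / y ≤ 2 * (t - s) / N := by
      rw [div_le_div_iff₀ hy hN]
      nlinarith
    have b2 : (s / z) * ((z - y) / y) ≤ 1 * ((t - s) / y) := by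
      have : 0 ≤ (z - y) / y := div_nonneg (sub_nonneg.2 hF) hy.le
      gcongr
      exact hw.trans hw1
    have e2 : 4 * (t - s) / N = 2 * (t - s) / N + 2 * (t - s) / N := by ring
    linarith
  have hpow := pow_sub_pow_le_mul (div_nonneg hs hz.le) hw (k - 1)
  have hwt : (t / y) ^ (k - 1 - 1) ≤ 1 := pow_le_one₀ (div_nonneg (hs.trans hst) hy.le) hw1
  have hwt0 : 0 ≤ (t / y) ^ (k - 1 - 1) := pow_nonneg (div_nonneg (hs.trans hst) hy.le) _
  unfold curveSlope
  calc (t / y) ^ (k - 1) - (s / z) ^ (k - 1)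
      ≤ ((k - 1 : ℕ) : ℝ) * (t / y) ^ (k - 1 - 1) * (t / y - s / z) := hpow
    _ ≤ k * 1 * (4 * (t - s) / N) := by
        have h0 : 0 ≤ t / y - s / z := sub_nonneg.2 hw
        have : ((k - 1 : ℕ) : ℝ) ≤ k := by exact_mod_cast Nat.sub_le _ _
        gcongr
    _ = 4 * k * (t - s) / N := by ring

/-- Points of the curve with slope near a fixed positive fraction `a / q` lie close together. -/
theorem sub_le_of_abs_curveSlope_sub_le (hk : 2 ≤ k) (hD : 0 < D) (hDN : 2 * D ^ k = N ^ k)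
    (hN : 0 < N) {s t : ℝ} (hs : 0 ≤ s) (hst : s ≤ t) (ht : t ≤ D) {Q q a : ℕ} (hQ : 1 ≤ Q)
    (hq : 1 ≤ q) (ha : 1 ≤ a) (h1 : |curveSlope k N s - a / q| ≤ 1 / ((Q + 1) * q))
    (h2 : |curveSlope k N t - a / q| ≤ 1 / ((Q + 1) * q)) : t - s ≤ 4 * N / (Q * a) := by
  have hmul := curveSlope_mul_le hk hD hDN hN hs hst ht
  have hDN' := (le_powProfile_of_le_diag (by omega) hD hDN hN (t := s) ⟨hs, hst.trans ht⟩).2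
  have hQ' : (1 : ℝ) ≤ Q := by exact_mod_cast hQ
  have hq' : (1 : ℝ) ≤ q := by exact_mod_cast hq
  have ha' : (1 : ℝ) ≤ a := by exact_mod_cast ha
  have b1 := (abs_le.1 h1).1
  have b2 := (abs_le.1 h2).2
  -- The approximation error is at most half of `a / q`, so the slope at `s` is at least `a / (2 *
  -- q)`.
  have e : 1 / (((Q : ℝ) + 1) * q) ≤ a / (2 * q) := by
    rw [div_le_div_iff₀ (by positivity) (by positivity)]
    have : 2 ≤ (a : ℝ) * (Q + 1) := by nlinarith
    nlinarith
  have e2 : (a : ℝ) / q = a / (2 * q) + a / (2 * q) := by field_simp; ring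
  have lo : a / (2 * q) ≤ curveSlope k N s := by linarith
  have e3 : 1 / (((Q : ℝ) + 1) * q) ≤ 1 / (Q * q) := by gcongr; linarith
  have hd : curveSlope k N t - curveSlope k N s ≤ 2 / (Q * q) := by
    have : (2 : ℝ) / (Q * q) = 1 / (Q * q) + 1 / (Q * q) := by ring
    linarith
  -- Superlinear growth of the slope reads `slope(s) * (t - s) ≤ (slope(t) - slope(s)) * s`, which
  -- turns closeness of slopes into closeness of points and gains the factor `1 / a`.
  have k1 : a / (2 * q) * (t - s) ≤ 2 / (Q * q) * N := by
    calc a / (2 * q) * (t - s) ≤ curveSlope k N s * (t - s) :=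
          mul_le_mul_of_nonneg_right lo (sub_nonneg.2 hst)
      _ ≤ (curveSlope k N t - curveSlope k N s) * s := by linarith
      _ ≤ 2 / (Q * q) * s := mul_le_mul_of_nonneg_right hd hs
      _ ≤ 2 / (Q * q) * N := by
          have : s ≤ N := by linarith
          gcongr
  have e4 : a / (2 * q) * (t - s) = (a * (t - s)) / (2 * q) := by ring
  have e5 : 2 / (Q * q) * N = (4 * N / Q) / (2 * q) := by field_simp; ring
  rw [e4, e5, div_le_div_iff_of_pos_right (by positivity)] at k1
  have e6 : 4 * N / (Q * a) = (4 * N / Q) / a := by field_simp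
  rw [e6, le_div_iff₀ (by positivity)]
  linarith

end Slope

/-! ### Decomposition into blocks -/

/-- Greedy decomposition of an interval of integers into blocks, a block starting at `n` having
length `q n`. -/
theorem exists_block_starts (ψ : ℕ → ℝ) (q : ℕ → ℕ) {E Q : ℕ} {C : ℝ} (hψ : ∀ n, |ψ n| ≤ 1)
    (A : ℕ) (hq : ∀ n ∈ Finset.Ico A E, 1 ≤ q n ∧ q n ≤ Q)
    (hb : ∀ n ∈ Finset.Ico A E, n + q n ≤ E → |∑ j ∈ Finset.range (q n), ψ (n + j)| ≤ C) :
    ∃ B ⊆ Finset.Ico A E, (∀ m ∈ B, ∀ n ∈ B, m < n → m + q m ≤ n) ∧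
      |∑ m ∈ Finset.Ico A E, ψ m| ≤ C * B.card + Q := by
  induction hd : E - A using Nat.strong_induction_on generalizing A with
  | _ d ih =>
    subst hd
    by_cases hAE : A < E
    · have hA : A ∈ Finset.Ico A E := Finset.mem_Ico.2 ⟨le_rfl, hAE⟩
      obtain ⟨hq1, hqQ⟩ := hq A hA
      by_cases hfit : A + q A ≤ E
      · have hsub : Finset.Ico (A + q A) E ⊆ Finset.Ico A E :=
          Finset.Ico_subset_Ico (by omega) le_rfl
        obtain ⟨B, hB, hsep, hsum⟩ := ih (E - (A + q A)) (by omega) (A + q A)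
          (fun n hn => hq n (hsub hn)) (fun n hn => hb n (hsub hn)) rfl
        have hge : ∀ m ∈ B, A + q A ≤ m := fun m hm => (Finset.mem_Ico.1 (hB hm)).1
        have hnot : A ∉ B := fun h => by have := hge A h; omega
        refine ⟨insert A B, Finset.insert_subset hA (hB.trans hsub), ?_, ?_⟩
        · intro m hm n hn hmn
          rcases Finset.mem_insert.1 hm with hm' | hm'
          · rcases Finset.mem_insert.1 hn with hn' | hn'
            · omega
            · rw [hm']; exact hge n hn'
          · rcases Finset.mem_insert.1 hn with hn' | hn'
            · have := hge m hm'; omega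
            · exact hsep m hm' n hn' hmn
        · rw [← Finset.sum_Ico_consecutive _ (Nat.le_add_right A (q A)) hfit,
            Finset.card_insert_of_notMem hnot]
          have h1 : ∑ m ∈ Finset.Ico A (A + q A), ψ m =
              ∑ j ∈ Finset.range (q A), ψ (A + j) := by
            rw [Finset.sum_Ico_eq_sum_range, Nat.add_sub_cancel_left]
          rw [h1]
          push_cast
          have := abs_add_le (∑ j ∈ Finset.range (q A), ψ (A + j))
            (∑ m ∈ Finset.Ico (A + q A) E, ψ m)
          have := hb A hA hfit
          linarith
      -- The last block overruns `E`: at most `Q` terms are left, each bounded by `1`.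
      · refine ⟨∅, Finset.empty_subset _, by simp, ?_⟩
        refine (Finset.abs_sum_le_sum_abs _ _).trans ?_
        refine (Finset.sum_le_card_nsmul _ _ 1 fun m _ => hψ m).trans ?_
        rw [Nat.card_Ico, nsmul_eq_mul, mul_one, Finset.card_empty, Nat.cast_zero, mul_zero,
          zero_add]
        exact_mod_cast (by omega : E - A ≤ Q)
    · refine ⟨∅, Finset.empty_subset _, by simp, ?_⟩
      rw [Finset.Ico_eq_empty hAE]
      simp

/-- A set of integers with gaps at least `q` and diameter at most `L` has at most `L / q + 2`
elements. -/
theorem card_le_of_separated {B : Finset ℕ} {q : ℕ} (hq : 1 ≤ q) {L : ℝ} (hL : 0 ≤ L)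
    (hsep : ∀ m ∈ B, ∀ n ∈ B, m < n → m + q ≤ n)
    (hdiam : ∀ m ∈ B, ∀ n ∈ B, m < n → (n : ℝ) - m ≤ L) : (B.card : ℝ) ≤ L / q + 2 := by
  have hq' : (0 : ℝ) < q := by exact_mod_cast hq
  rcases B.eq_empty_or_nonempty with rfl | hne
  · simp only [Finset.card_empty, Nat.cast_zero]; positivity
  set u := B.min' hne
  set v := B.max' hne
  have huv : u ≤ v := B.min'_le_max' hne
  have hd : (v : ℝ) - u ≤ L := by
    rcases huv.eq_or_lt with h | h
    · rw [h, sub_self]; exact hL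
    · exact hdiam u (B.min'_mem hne) v (B.max'_mem hne) h
  -- Points at distance at least `q` fall into different cells of length `q` counted from the
  -- minimum `u`.
  have hinj : Set.InjOn (fun n => (n - u) / q) (B : Set ℕ) := by
    have key : ∀ m ∈ B, ∀ n ∈ B, m < n → (m - u) / q < (n - u) / q := by
      intro m hm n hn hmn
      have h1 := hsep m hm n hn hmn
      have h2 : u ≤ m := B.min'_le m hm
      have h3 : (m - u) / q + 1 = (m - u + q) / q := (Nat.add_div_right _ hq).symm
      have h4 : (m - u + q) / q ≤ (n - u) / q := Nat.div_le_div_right (by omega)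
      omega
    intro m hm n hn hmn
    rcases lt_trichotomy m n with h | h | h
    · have := key m hm n hn h; simp only at hmn; omega
    · exact h
    · have := key n hn m hm h; simp only at hmn; omega
  have hcard : B.card ≤ (v - u) / q + 1 := by
    rw [← Finset.card_image_of_injOn hinj, ← Finset.card_range ((v - u) / q + 1)]
    apply Finset.card_le_card
    intro x hx
    obtain ⟨n, hn, rfl⟩ := Finset.mem_image.1 hx
    rw [Finset.mem_range, Nat.lt_succ_iff]
    exact Nat.div_le_div_right (Nat.sub_le_sub_right (B.le_max' n hn) _)
  have h5 : (((v - u) / q : ℕ) : ℝ) ≤ L / q := by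
    refine Nat.cast_div_le.trans ?_
    rw [Nat.cast_sub huv]
    gcongr
  have h6 : (B.card : ℝ) ≤ (((v - u) / q : ℕ) : ℝ) + 1 := by exact_mod_cast hcard
  linarith

/-- Counting block starts fibre by fibre over the fractions attached to them. -/
theorem card_le_of_fibers {B : Finset ℕ} {Q : ℕ} {L : ℝ} (hL : 0 ≤ L) (a q : ℕ → ℕ)
    (ha : ∀ n ∈ B, a n ∈ Finset.Icc 1 Q) (hq : ∀ n ∈ B, q n ∈ Finset.Icc 1 Q)
    (hsep : ∀ m ∈ B, ∀ n ∈ B, m < n → m + q m ≤ n)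
    (hdiam : ∀ m ∈ B, ∀ n ∈ B, m < n → a m = a n → q m = q n → (n : ℝ) - m ≤ L / a m) :
    (B.card : ℝ) ≤ L * (1 + Real.log Q) ^ 2 + 2 * Q ^ 2 := by
  classical
  have hfib : B.card = ∑ p ∈ Finset.Icc 1 Q ×ˢ Finset.Icc 1 Q,
      (B.filter fun n => (a n, q n) = p).card :=
    Finset.card_eq_sum_card_fiberwise fun n hn => Finset.mem_product.2 ⟨ha n hn, hq n hn⟩
  have hharm : ∑ i ∈ Finset.Icc 1 Q, (1 : ℝ) / i ≤ 1 + Real.log Q := by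
    have h := harmonic_le_one_add_log Q
    rw [harmonic_eq_sum_Icc] at h
    push_cast at h
    simpa [one_div] using h
  have hharm0 : 0 ≤ ∑ i ∈ Finset.Icc 1 Q, (1 : ℝ) / i := Finset.sum_nonneg fun i _ => by positivity
  rw [hfib, Nat.cast_sum]
  calc ∑ p ∈ Finset.Icc 1 Q ×ˢ Finset.Icc 1 Q, ((B.filter fun n => (a n, q n) = p).card : ℝ)
      ≤ ∑ p ∈ Finset.Icc 1 Q ×ˢ Finset.Icc 1 Q,
          (L * ((1 : ℝ) / p.1 * (1 / p.2)) + 2) := by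
        refine Finset.sum_le_sum fun p hp => ?_
        obtain ⟨hp1, hp2⟩ := Finset.mem_product.1 hp
        have hp2' := (Finset.mem_Icc.1 hp2).1
        have e : L * ((1 : ℝ) / p.1 * (1 / p.2)) + 2 = L / p.1 / p.2 + 2 := by ring
        rw [e]
        refine card_le_of_separated hp2' (by positivity) ?_ ?_
        · intro m hm n hn hmn
          obtain ⟨hm, hm'⟩ := Finset.mem_filter.1 hm
          have := hsep m hm n (Finset.mem_filter.1 hn).1 hmn
          rwa [← hm']
        · intro m hm n hn hmn
          obtain ⟨hm, hm'⟩ := Finset.mem_filter.1 hm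
          obtain ⟨hn, hn'⟩ := Finset.mem_filter.1 hn
          have h := hm'.trans hn'.symm
          rw [Prod.mk.injEq] at h
          have := hdiam m hm n hn hmn h.1 h.2
          rwa [← hm']
    _ = L * (∑ i ∈ Finset.Icc 1 Q, (1 : ℝ) / i) ^ 2 + 2 * Q ^ 2 := by
        rw [Finset.sum_add_distrib, ← Finset.mul_sum, sq (∑ i ∈ Finset.Icc 1 Q, (1 : ℝ) / i),
          Finset.sum_mul_sum, ← Finset.sum_product', Finset.sum_const, Finset.card_product,
          Nat.card_Icc, Nat.add_sub_cancel, nsmul_eq_mul]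
        push_cast
        ring
    _ ≤ L * (1 + Real.log Q) ^ 2 + 2 * Q ^ 2 := by gcongr

/-! ### The sawtooth sum over the curved part -/

/-- Dirichlet approximation by a positive reduced fraction of a number in `[1 / Q, 1]`. -/
theorem exists_nat_div_approx {ξ : ℝ} {Q : ℕ} (hQ : 1 ≤ Q) (h0 : 1 / (Q : ℝ) ≤ ξ) (h1 : ξ ≤ 1) :
    ∃ a q : ℕ, 1 ≤ a ∧ a ≤ Q ∧ 1 ≤ q ∧ q ≤ Q ∧ Nat.Coprime a q ∧
      |ξ - a / q| ≤ 1 / ((Q + 1) * q) := by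
  obtain ⟨r, hr, hrQ⟩ := Real.exists_rat_abs_sub_le_and_den_le ξ hQ
  have hq : (0 : ℝ) < r.den := by exact_mod_cast r.den_pos
  have hQ' : (0 : ℝ) < Q := by exact_mod_cast hQ
  have hqQ : (r.den : ℝ) ≤ Q := by exact_mod_cast hrQ
  have hq1 : (1 : ℝ) ≤ r.den := by exact_mod_cast r.den_pos
  have hcast : (r : ℝ) = (r.num : ℝ) / r.den := Rat.cast_def r
  -- Since `ξ ≥ 1 / Q` exceeds the approximation error, the numerator is positive; `ξ ≤ 1` then
  -- keeps it at most the denominator.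
  have hlt : 1 / (((Q : ℝ) + 1) * r.den) < ξ := by
    refine lt_of_lt_of_le ?_ h0
    apply one_div_lt_one_div_of_lt hQ'
    nlinarith
  have hnum : 0 < r.num := by
    have : (0 : ℝ) < (r.num : ℝ) / r.den := by
      rw [← hcast]; linarith [(abs_le.1 hr).2]
    rw [div_pos_iff_of_pos_right hq] at this
    exact_mod_cast this
  have hle : r.num ≤ r.den := by
    have h2 : (r.num : ℝ) / r.den ≤ 1 + 1 / ((Q + 1) * r.den) := by
      rw [← hcast]; linarith [(abs_le.1 hr).1]
    rw [div_le_iff₀ hq] at h2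
    have h3 : (1 + 1 / (((Q : ℝ) + 1) * r.den)) * r.den = r.den + 1 / (Q + 1) := by field_simp
    have h4 : 1 / ((Q : ℝ) + 1) < 1 := by rw [div_lt_one (by positivity)]; linarith
    have h5 : (r.num : ℝ) < r.den + 1 := by linarith
    have h6 : r.num < (r.den : ℤ) + 1 := by exact_mod_cast h5
    omega
  have hnat : ((r.num.natAbs : ℕ) : ℝ) = r.num := by
    rw [Nat.cast_natAbs, abs_of_pos hnum]
  refine ⟨r.num.natAbs, r.den, by omega, by omega, r.den_pos, hrQ, r.reduced, ?_⟩
  rw [hnat, ← hcast]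
  exact hr

section Curved

variable {k : ℕ} {N D : ℝ}

/-- On a block of length `q` on which the slope starts near `a / q`, the heights of the curve are
nearly in arithmetic progression. -/
theorem abs_powProfile_sub_linear_le (hk : k ≠ 0) (hD : 0 < D) (hDN : 2 * D ^ k = N ^ k)
    (hN : 0 < N) {n a q Q j : ℕ} (hqQ : q ≤ Q) (hQ : (Q : ℝ) ^ 3 ≤ 8 * N) (hj : j < q)
    (hnD : ((n + j : ℕ) : ℝ) ≤ D)
    (happ : |curveSlope k N n - a / q| ≤ 1 / ((Q + 1) * q)) :
    |powProfile k N (1 / k) ((n + j : ℕ) : ℝ) -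
      (powProfile k N (1 / k) n + ((-(a : ℤ) : ℤ) : ℝ) * j / q)| ≤ (32 * k + 1) / q := by
  have hq : (0 : ℝ) < q := by exact_mod_cast (Nat.zero_le j).trans_lt hj
  have hn0 : (0 : ℝ) ≤ n := Nat.cast_nonneg n
  have hj0 : (0 : ℝ) ≤ j := Nat.cast_nonneg j
  have hjq : (j : ℝ) ≤ q := by exact_mod_cast hj.le
  have hqQ' : (q : ℝ) ≤ Q := by exact_mod_cast hqQ
  push_cast at hnD ⊢
  have hst : (n : ℝ) ≤ n + j := by linarith
  have hlt := (le_powProfile_of_le_diag hk hD hDN hN ⟨le_rfl, hD.le⟩).2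
  obtain ⟨c1, c2⟩ := powProfile_sub_mem hk hn0 hst (hnD.trans_lt hlt)
  have c3 := curveSlope_sub_le hk hD hDN hN hn0 hst hnD
  rw [add_sub_cancel_left] at c1 c2 c3
  -- The slope drifts by `O(q / N)` along the block, which moves heights by `O(q ^ 2 / N)`; this is
  -- `O(1 / q)` because `q ^ 3 ≤ 8 * N`.
  have d1 : (curveSlope k N (n + j) - curveSlope k N n) * j ≤ 32 * k / q := by
    calc (curveSlope k N (n + j) - curveSlope k N n) * j ≤ (4 * k * j / N) * j := by gcongr
      _ ≤ (4 * k * q / N) * q := by gcongr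
      _ ≤ 32 * k / q := by
        rw [div_mul_eq_mul_div, div_le_div_iff₀ hN hq]
        have : (q : ℝ) ^ 3 ≤ Q ^ 3 := by gcongr
        have h8 : (q : ℝ) ^ 3 ≤ 8 * N := this.trans hQ
        calc 4 * (k : ℝ) * q * q * q = 4 * k * q ^ 3 := by ring
          _ ≤ 4 * k * (8 * N) := by gcongr
          _ = 32 * k * N := by ring
  have d2 : |curveSlope k N n * j - a * j / q| ≤ 1 / q := by
    have e : curveSlope k N n * j - a * j / q = (curveSlope k N n - a / q) * j := by ring
    rw [e, abs_mul, abs_of_nonneg hj0]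
    calc |curveSlope k N n - a / q| * j ≤ 1 / ((Q + 1) * q) * j := by gcongr
      _ = (j / (Q + 1)) * (1 / q) := by field_simp
      _ ≤ 1 * (1 / q) := by
        gcongr
        rw [div_le_one (by positivity)]
        linarith
      _ = 1 / q := one_mul _
  rw [add_div]
  have e : ((-(a : ℝ)) * j / q) = -(a * j / q) := by ring
  rw [e]
  rw [abs_le] at d2 ⊢
  constructor <;> linarith [d2.1, d2.2]

/-- The sawtooth sum over the part of the curve with slope between `1 / Q` and `1`. -/
theorem abs_sum_sawtooth_curved_le (hk : 2 ≤ k) (hD : 0 < D) (hDN : 2 * D ^ k = N ^ k)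
    (hN : 0 < N) {A Q : ℕ} (hQ1 : 1 ≤ Q) (hQ : (Q : ℝ) ^ 3 ≤ 8 * N)
    (hA : ∀ n ∈ Finset.Ico A (⌊D⌋₊ + 1), 1 / (Q : ℝ) ≤ curveSlope k N n) :
    |∑ m ∈ Finset.Ico A (⌊D⌋₊ + 1), sawtooth (powProfile k N (1 / k) m)| ≤
      (64 * k + 3) * (4 * N / Q * (1 + Real.log Q) ^ 2 + 2 * Q ^ 2) + Q := by
  classical
  have hk0 : k ≠ 0 := by omega
  set E := ⌊D⌋₊ + 1 with hE
  have hmem : ∀ n < E, (n : ℝ) ∈ Set.Icc 0 D := fun n hn =>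
    ⟨Nat.cast_nonneg n, (Nat.cast_le.2 (Nat.lt_succ_iff.1 hn)).trans (Nat.floor_le hD.le)⟩
  have hex : ∀ n, ∃ p : ℕ × ℕ, n ∈ Finset.Ico A E → 1 ≤ p.1 ∧ p.1 ≤ Q ∧ 1 ≤ p.2 ∧ p.2 ≤ Q ∧
      Nat.Coprime p.1 p.2 ∧ |curveSlope k N n - p.1 / p.2| ≤ 1 / ((Q + 1) * p.2) := by
    intro n
    by_cases hn : n ∈ Finset.Ico A E
    · obtain ⟨a, q, h⟩ := exists_nat_div_approx hQ1 (hA n hn)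
        (curveSlope_le_one hk0 hD hDN hN (hmem n (Finset.mem_Ico.1 hn).2))
      exact ⟨(a, q), fun _ => h⟩
    · exact ⟨(0, 0), fun h => absurd h hn⟩
  choose p hp using hex
  -- The block constant `64 * k + 3` is `1 / 2 + 2 * (32 * k + 1)`, rounded up.
  obtain ⟨B, hB, hsep, hsum⟩ := exists_block_starts
    (fun m => sawtooth (powProfile k N (1 / k) m)) (fun n => (p n).2) (E := E) (Q := Q)
    (C := 64 * k + 3) (fun n => (abs_sawtooth_le _).trans (by norm_num)) A
    (fun n hn => ⟨(hp n hn).2.2.1, (hp n hn).2.2.2.1⟩) (by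
      intro n hn hfit
      obtain ⟨-, -, hq1, hqQ, hcop, happ⟩ := hp n hn
      have hc : IsCoprime (-((p n).1 : ℤ)) ((p n).2 : ℤ) :=
        (Nat.isCoprime_iff_coprime.2 hcop).neg_left
      refine (abs_sum_sawtooth_block_le hq1 hc (c := powProfile k N (1 / k) n)
        (K := 32 * k + 1) (h := fun j => powProfile k N (1 / k) ((n + j : ℕ) : ℝ)) ?_).trans
          (by linarith)
      intro j hj
      exact abs_powProfile_sub_linear_le hk0 hD hDN hN hqQ hQ hj (hmem _ (by omega)).2 happ)
  have hcard := card_le_of_fibers (B := B) (Q := Q) (L := 4 * N / Q) (by positivity)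
    (fun n => (p n).1) (fun n => (p n).2)
    (fun n hn => Finset.mem_Icc.2 ⟨(hp n (hB hn)).1, (hp n (hB hn)).2.1⟩)
    (fun n hn => Finset.mem_Icc.2 ⟨(hp n (hB hn)).2.2.1, (hp n (hB hn)).2.2.2.1⟩) hsep (by
      intro m hm n hn hmn ha hq
      obtain ⟨ha1, -, hq1, -, -, h1⟩ := hp m (hB hm)
      obtain ⟨-, -, -, -, -, h2⟩ := hp n (hB hn)
      rw [← ha, ← hq] at h2
      have := sub_le_of_abs_curveSlope_sub_le hk hD hDN hN (Nat.cast_nonneg m)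
        (Nat.cast_le.2 hmn.le) (hmem n (Finset.mem_Ico.1 (hB hn)).2).2 hQ1 hq1 ha1 h1 h2
      rwa [← div_div] at this)
  refine hsum.trans ?_
  gcongr

/-- The sawtooth sum over the curved part, with fractions of denominator about `N ^ (1 / 3)`. -/
theorem exists_bound_sum_sawtooth_curved (k : ℕ) (hk : 2 ≤ k) :
    ∃ C : ℝ, 0 ≤ C ∧ ∀ N D : ℝ, 1 ≤ N → 0 < D → 2 * D ^ k = N ^ k →
      |curveSawtoothSum k N D -
        curveSawtoothSum k N (N * (1 / ((⌊N ^ (1 / 3 : ℝ)⌋₊ : ℝ) + 1)) ^ (1 / (k : ℝ)))| ≤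
          C * N ^ (3 / 4 : ℝ) := by
  refine ⟨(64 * k + 3) * (4 * 578 + 8) + 2, by positivity, ?_⟩
  intro N D hN1 hD hDN
  have hk0 : k ≠ 0 := by omega
  have hkR : (k : ℝ) ≠ 0 := by exact_mod_cast hk0
  have hN : 0 < N := by linarith
  set u := N ^ (1 / 3 : ℝ) with hu
  have hu1 : 1 ≤ u := Real.one_le_rpow hN1 (by norm_num)
  set Q := ⌊u⌋₊ + 1 with hQdef
  have hQcast : (⌊u⌋₊ : ℝ) + 1 = (Q : ℝ) := by rw [hQdef]; push_cast; ring
  rw [hQcast]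
  have hQu : u ≤ Q := by rw [← hQcast]; exact (Nat.lt_floor_add_one u).le
  have hQ2u : (Q : ℝ) ≤ 2 * u := by
    rw [← hQcast]; linarith [Nat.floor_le (zero_le_one.trans hu1)]
  have hQ0 : (0 : ℝ) < Q := by linarith
  have hQ2 : (2 : ℝ) ≤ Q := by
    rw [← hQcast]
    have : (1 : ℝ) ≤ ⌊u⌋₊ := by exact_mod_cast (Nat.one_le_floor_iff u).2 hu1
    linarith
  have hu3 : u ^ 3 = N := by
    rw [hu, ← Real.rpow_natCast, ← Real.rpow_mul hN.le]; norm_num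
  have hQ3 : (Q : ℝ) ^ 3 ≤ 8 * N := by
    calc (Q : ℝ) ^ 3 ≤ (2 * u) ^ 3 := by gcongr
      _ = 8 * N := by rw [mul_pow, hu3]; norm_num
  -- Beyond `N * w` the slope is at least `w ^ (k - 1) ≥ w ^ k = 1 / Q`, as the Dirichlet step
  -- requires.
  set w := (1 / (Q : ℝ)) ^ (1 / (k : ℝ)) with hw
  have hw0 : 0 ≤ w := by positivity
  have hwk : w ^ k = 1 / Q := by
    rw [hw, one_div (k : ℝ)]; exact Real.rpow_inv_natCast_pow (by positivity) hk0
  have hw1 : w ≤ 1 := by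
    apply le_of_pow_le_pow_left₀ hk0 zero_le_one
    rw [hwk, one_pow, div_le_one hQ0]; linarith
  have hMD : N * w ≤ D := by
    apply le_of_pow_le_pow_left₀ hk0 hD.le
    rw [mul_pow, hwk, ← hDN]
    have : 2 * D ^ k * (1 / Q) ≤ 2 * D ^ k * (1 / 2) := by gcongr
    linarith
  have hfl : ⌊N * w⌋₊ ≤ ⌊D⌋₊ := Nat.floor_le_floor hMD
  have hdiff : curveSawtoothSum k N D - curveSawtoothSum k N (N * w) =
      ∑ m ∈ Finset.Ico (⌊N * w⌋₊ + 1) (⌊D⌋₊ + 1), sawtooth (powProfile k N (1 / k) m) := by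
    unfold curveSawtoothSum
    rw [sub_eq_iff_eq_add', ← Finset.sum_union]
    · congr 1
      ext m
      simp only [Finset.mem_union, Finset.mem_Icc, Finset.mem_Ico]
      omega
    · rw [Finset.disjoint_left]
      intro m h1 h2
      have := (Finset.mem_Icc.1 h1).2
      have := (Finset.mem_Ico.1 h2).1
      omega
  rw [hdiff]
  have hbound := abs_sum_sawtooth_curved_le hk hD hDN hN (A := ⌊N * w⌋₊ + 1) (Q := Q)
    (by omega) hQ3 (by
      intro n hn
      rw [Finset.mem_Ico] at hn
      have hnD : (n : ℝ) ≤ D :=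
        (Nat.cast_le.2 (Nat.lt_succ_iff.1 hn.2)).trans (Nat.floor_le hD.le)
      refine le_trans ?_ (pow_div_le_curveSlope hk0 hD hDN hN ⟨Nat.cast_nonneg n, hnD⟩)
      have hnw : w ≤ n / N := by
        rw [le_div_iff₀ hN, mul_comm]
        exact (Nat.lt_of_floor_lt (Nat.lt_of_succ_le hn.1)).le
      calc 1 / (Q : ℝ) = w ^ k := hwk.symm
        _ ≤ w ^ (k - 1) := pow_le_pow_of_le_one hw0 hw1 (Nat.sub_le _ _)
        _ ≤ (n / N) ^ (k - 1) := by gcongr)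
  refine hbound.trans ?_
  -- A common base: `u = v ^ 8` and `N ^ (3 / 4) = v ^ 18`. The squared logarithm costs one factor
  -- `v`, giving `v ^ 17` in all.
  set v := N ^ (1 / 24 : ℝ) with hv
  have hv1 : 1 ≤ v := Real.one_le_rpow hN1 (by norm_num)
  have huv : u = v ^ 8 := by
    rw [hu, hv, ← Real.rpow_natCast, ← Real.rpow_mul hN.le]; norm_num
  have hN34 : N ^ (3 / 4 : ℝ) = v ^ 18 := by
    rw [hv, ← Real.rpow_natCast, ← Real.rpow_mul hN.le]; norm_num
  have hlog : (1 + Real.log Q) ^ 2 ≤ 578 * v := by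
    set z := (Q : ℝ) ^ (1 / 16 : ℝ) with hz
    have hz1 : 1 ≤ z := Real.one_le_rpow (by linarith) (by norm_num)
    have h1 : Real.log Q ≤ 16 * z := by
      have := Real.log_le_rpow_div hQ0.le (show (0 : ℝ) < 1 / 16 by norm_num)
      linarith
    have h0 : 0 ≤ Real.log Q := Real.log_nonneg (by linarith)
    have hz2 : z ^ 2 ≤ 2 * v := by
      apply le_of_pow_le_pow_left₀ (n := 8) (by norm_num) (by positivity)
      rw [← pow_mul]
      have : z ^ (2 * 8) = Q := by
        rw [hz, ← Real.rpow_natCast, ← Real.rpow_mul hQ0.le]; norm_num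
      rw [this, mul_pow, ← huv]
      linarith
    calc (1 + Real.log Q) ^ 2 ≤ (17 * z) ^ 2 := by gcongr; linarith
      _ = 289 * z ^ 2 := by ring
      _ ≤ 289 * (2 * v) := by gcongr
      _ = 578 * v := by ring
  have hNQ : 4 * N / Q ≤ 4 * v ^ 16 := by
    rw [div_le_iff₀ hQ0, ← hu3]
    have : v ^ 16 = u ^ 2 := by rw [huv]; ring
    rw [this]
    have : 4 * u ^ 2 * u ≤ 4 * u ^ 2 * Q := by gcongr
    linarith
  have hQQ : 2 * (Q : ℝ) ^ 2 ≤ 8 * v ^ 16 := by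
    have h1 : (Q : ℝ) ^ 2 ≤ (2 * u) ^ 2 := by gcongr
    have h2 : (2 * u) ^ 2 = 4 * v ^ 16 := by rw [huv]; ring
    linarith
  have m1 : v ^ 16 ≤ v ^ 18 := pow_le_pow_right₀ hv1 (by norm_num)
  have m2 : v ^ 17 ≤ v ^ 18 := pow_le_pow_right₀ hv1 (by norm_num)
  have m3 : v ^ 8 ≤ v ^ 18 := pow_le_pow_right₀ hv1 (by norm_num)
  rw [hN34]
  have hin : 4 * N / Q * (1 + Real.log Q) ^ 2 + 2 * Q ^ 2 ≤ (4 * 578 + 8) * v ^ 18 := by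
    have : 4 * N / Q * (1 + Real.log Q) ^ 2 ≤ 4 * v ^ 16 * (578 * v) := by gcongr
    have e : 4 * v ^ 16 * (578 * v) = 4 * 578 * v ^ 17 := by ring
    linarith
  calc (64 * k + 3) * (4 * N / Q * (1 + Real.log Q) ^ 2 + 2 * Q ^ 2) + Q
      ≤ (64 * k + 3) * ((4 * 578 + 8) * v ^ 18) + 2 * v ^ 18 := by
        gcongr
        linarith
    _ = ((64 * k + 3) * (4 * 578 + 8) + 2) * v ^ 18 := by ring

/-- The sawtooth sum over the whole curve. -/
theorem exists_bound_curveSawtoothSum (k : ℕ) (hk : 4 ≤ k) :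
    ∃ C : ℝ, 0 ≤ C ∧ ∀ N : ℝ, 1 ≤ N → |curveSawtoothSum k N N| ≤ C * N ^ (1 - 1 / (k : ℝ)) := by
  obtain ⟨C, hC0, hC⟩ := exists_bound_sum_sawtooth_curved k (by omega)
  refine ⟨2 * C + 3 * (12 * k + 2) + 4, by positivity, ?_⟩
  intro N hN1
  have hk0 : k ≠ 0 := by omega
  have hk4 : (4 : ℝ) ≤ k := by exact_mod_cast hk
  have hN : 0 < N := by linarith
  set P := N ^ (1 - 1 / (k : ℝ)) with hP
  have hkinv : 1 / (k : ℝ) ≤ 1 / 4 := one_div_le_one_div_of_le (by norm_num) hk4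
  have hP34 : N ^ (3 / 4 : ℝ) ≤ P := Real.rpow_le_rpow_of_exponent_le hN1 (by linarith)
  have hP1 : 1 ≤ P := Real.one_le_rpow hN1 (by linarith)
  have hR : (2 * k * N ^ (k - 1)) ^ (1 / (k : ℝ)) ≤ 2 * k * P := by
    rw [Real.mul_rpow (by positivity) (by positivity)]
    have h1 : (N ^ (k - 1)) ^ (1 / (k : ℝ)) = P := by
      rw [← Real.rpow_natCast, ← Real.rpow_mul hN.le, hP, Nat.cast_sub (by omega)]
      congr 1
      field_simp
      simp
    rw [h1]
    have h2 : (2 * (k : ℝ)) ^ (1 / (k : ℝ)) ≤ (2 * (k : ℝ)) ^ (1 : ℝ) :=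
      Real.rpow_le_rpow_of_exponent_le (by linarith) (by linarith)
    rw [Real.rpow_one] at h2
    gcongr
  -- The fixed point of the involution: reciprocity at `D` expresses the full sum as twice the sum
  -- up to `D`.
  set D := (N ^ k / 2) ^ (1 / (k : ℝ)) with hDdef
  have hD : 0 < D := by positivity
  have hDk : D ^ k = N ^ k / 2 := by
    rw [hDdef, one_div (k : ℝ)]; exact Real.rpow_inv_natCast_pow (by positivity) hk0
  have hDN : 2 * D ^ k = N ^ k := by rw [hDk]; ring
  have hDlt := (le_powProfile_of_le_diag hk0 hD hDN hN (t := D) ⟨hD.le, le_rfl⟩).2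
  have hDmem : D ∈ Set.Icc 0 N := ⟨hD.le, hDlt.le⟩
  have hFD : powProfile k N (1 / k) D = D := by
    apply (pow_left_inj₀ (powProfile_mem hk0 hDmem).1 hD.le hk0).1
    rw [powProfile_pow hk0 hDmem]; linarith
  have r1 := abs_curveSawtoothSum_reciprocity hk0 hDmem
  rw [hFD] at r1
  have c1 := hC N D hN1 hD hDN
  set u := N ^ (1 / 3 : ℝ) with hu
  have hu1 : 1 ≤ u := Real.one_le_rpow hN1 (by norm_num)
  set Q : ℝ := (⌊u⌋₊ : ℝ) + 1 with hQ
  have hQu : u ≤ Q := (Nat.lt_floor_add_one u).le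
  have hQ1 : 1 ≤ Q := hu1.trans hQu
  set M := N * (1 / Q) ^ (1 / (k : ℝ)) with hM
  have hMk : M ^ k = N ^ k / Q := by
    have : ((1 / Q) ^ (1 / (k : ℝ))) ^ k = 1 / Q := by
      rw [one_div (k : ℝ)]; exact Real.rpow_inv_natCast_pow (by positivity) hk0
    rw [hM, mul_pow, this]; ring
  have hMmem : M ∈ Set.Icc 0 N := by
    refine ⟨by positivity, ?_⟩
    apply le_of_pow_le_pow_left₀ hk0 hN.le
    rw [hMk]
    exact div_le_self (by positivity) hQ1
  have r2 := abs_curveSawtoothSum_reciprocity hk0 hMmem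
  have hFM := powProfile_mem hk0 hMmem
  have c2 := abs_curveSawtoothSum_sub_le (k := k) (N := N) hFM.1 hFM.2
  have hFM2 : N - powProfile k N (1 / k) M ≤ P := by
    have h1 : N * (1 - 1 / Q) ≤ powProfile k N (1 / k) M := by
      apply le_of_pow_le_pow_left₀ hk0 hFM.1
      rw [powProfile_pow hk0 hMmem, hMk, mul_pow]
      have h01 : 0 ≤ 1 - 1 / Q := by
        rw [sub_nonneg, div_le_one (by linarith)]; exact hQ1
      have : (1 - 1 / Q) ^ k ≤ 1 - 1 / Q :=
        pow_le_of_le_one h01 (by linarith [show 0 ≤ 1 / Q by positivity]) hk0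
      calc N ^ k * (1 - 1 / Q) ^ k ≤ N ^ k * (1 - 1 / Q) := by gcongr
        _ = N ^ k - N ^ k / Q := by ring
    have h2 : N * (1 / Q) ≤ N * (1 / u) := by gcongr
    have h3 : N * (1 / u) = N ^ (2 / 3 : ℝ) := by
      rw [hu, one_div, ← Real.rpow_neg hN.le]
      nth_rewrite 1 [← Real.rpow_one N]
      rw [← Real.rpow_add hN]
      norm_num
    have h4 : N ^ (2 / 3 : ℝ) ≤ N ^ (3 / 4 : ℝ) :=
      Real.rpow_le_rpow_of_exponent_le hN1 (by norm_num)
    linarith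
  have hc : C * N ^ (3 / 4 : ℝ) ≤ C * P := by gcongr
  have e : (2 * C + 3 * (12 * k + 2) + 4) * P = 2 * (C * P) + 3 * (6 * (2 * k * P) + 2 * P) + 4 * P := by
    ring
  rw [e]
  rw [abs_le] at r1 r2 c1 c2 ⊢
  constructor <;> linarith [r1.1, r1.2, r2.1, r2.2, c1.1, c1.2, c2.1, c2.2]

end Curved

/-! ### Counting tuples with bounded power sum -/

/-- The set of `s`-tuples of positive integers whose `k`-th powers sum to at most `n`. -/
def powerRepsLE (k s n : ℕ) : Set (Fin s → ℕ) := {x | (∀ i, 0 < x i) ∧ ∑ i, x i ^ k ≤ n}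

theorem powerRepsLE_finite {k : ℕ} (hk : k ≠ 0) (s n : ℕ) : (powerRepsLE k s n).Finite := by
  refine ((Set.finite_Iic n).biUnion fun m _ => powerReps_finite hk s m).subset ?_
  rintro x ⟨hx, hn⟩
  exact Set.mem_biUnion (Set.mem_Iic.2 hn) ⟨hx, rfl⟩

theorem ncard_powerRepsLE_eq_sum {k : ℕ} (hk : k ≠ 0) (s n : ℕ) :
    (powerRepsLE k s n).ncard = ∑ m ∈ Finset.range (n + 1), powerRepCount k s m := by
  classical
  have hfin := powerRepsLE_finite hk s n
  rw [Set.ncard_eq_toFinset_card _ hfin,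
    Finset.card_eq_sum_card_fiberwise (f := fun x => ∑ i, x i ^ k) (t := Finset.range (n + 1))]
  · refine Finset.sum_congr rfl fun m hm => ?_
    unfold powerRepCount
    rw [← Set.ncard_coe_finset]
    congr 1
    ext x
    have := Finset.mem_range.1 hm
    simp only [Finset.coe_filter, Set.Finite.mem_toFinset, powerRepsLE, powerReps,
      Set.mem_ofPred_eq]
    constructor
    · rintro ⟨⟨h1, -⟩, h2⟩; exact ⟨h1, h2⟩
    · rintro ⟨h1, h2⟩; exact ⟨⟨h1, by omega⟩, h2⟩
  · intro x hx
    have := ((Set.Finite.mem_toFinset hfin).1 hx).2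
    exact Finset.mem_coe.2 (Finset.mem_range.2 (Nat.lt_succ_of_le this))

theorem le_floor_rpow_iff {k : ℕ} (hk : k ≠ 0) (n m : ℕ) :
    m ≤ ⌊(n : ℝ) ^ (1 / (k : ℝ))⌋₊ ↔ m ^ k ≤ n := by
  rw [Nat.le_floor_iff (by positivity), one_div,
    Real.le_rpow_inv_iff_of_pos (Nat.cast_nonneg m) (Nat.cast_nonneg n)
      (by exact_mod_cast Nat.pos_of_ne_zero hk), Real.rpow_natCast]
  exact_mod_cast Iff.rfl

/-- Fibring over the first coordinate gives the recursion behind the induction on the number of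
variables. -/
theorem ncard_powerRepsLE_succ {k : ℕ} (hk : k ≠ 0) (s n : ℕ) :
    (powerRepsLE k (s + 1) n).ncard =
      ∑ m ∈ Finset.Icc 1 ⌊(n : ℝ) ^ (1 / (k : ℝ))⌋₊, (powerRepsLE k s (n - m ^ k)).ncard := by
  classical
  have hfin := powerRepsLE_finite hk (s + 1) n
  rw [Set.ncard_eq_toFinset_card _ hfin,
    Finset.card_eq_sum_card_fiberwise (f := fun x => x 0)
      (t := Finset.Icc 1 ⌊(n : ℝ) ^ (1 / (k : ℝ))⌋₊)]
  · refine Finset.sum_congr rfl fun m hm => ?_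
    obtain ⟨hm1, hm2⟩ := Finset.mem_Icc.1 hm
    rw [le_floor_rpow_iff hk] at hm2
    rw [← Set.ncard_image_of_injective (powerRepsLE k s (n - m ^ k))
      (Fin.cons_right_injective (α := fun _ => ℕ) m), ← Set.ncard_coe_finset]
    congr 1
    ext x
    simp only [Finset.coe_filter, Set.Finite.mem_toFinset, powerRepsLE, Set.mem_ofPred_eq,
      Set.mem_image]
    constructor
    · rintro ⟨⟨h1, h2⟩, h3⟩
      refine ⟨Fin.tail x, ⟨fun i => h1 i.succ, ?_⟩, ?_⟩
      · rw [Fin.sum_univ_succ, h3] at h2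
        simp only [Fin.tail]
        omega
      · rw [← h3]; exact Fin.cons_self_tail x
    · rintro ⟨y, ⟨h1, h2⟩, rfl⟩
      refine ⟨⟨Fin.cases hm1 h1, ?_⟩, rfl⟩
      rw [Fin.sum_univ_succ]
      simp only [Fin.cons_zero, Fin.cons_succ]
      omega
  · intro x hx
    obtain ⟨h1, h2⟩ := (Set.Finite.mem_toFinset hfin).1 hx
    rw [Fin.sum_univ_succ] at h2
    refine Finset.mem_coe.2 (Finset.mem_Icc.2 ⟨h1 0, ?_⟩)
    rw [le_floor_rpow_iff hk]
    exact (Nat.le_add_right _ _).trans h2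

theorem ncard_powerRepsLE_zero_left (k n : ℕ) : (powerRepsLE k 0 n).ncard = 1 := by
  have : powerRepsLE k 0 n = Set.univ := by
    ext x; simp [powerRepsLE]
  rw [this, Set.ncard_univ]
  simp

theorem ncard_powerRepsLE_one {k : ℕ} (hk : k ≠ 0) (n : ℕ) :
    (powerRepsLE k 1 n).ncard = ⌊(n : ℝ) ^ (1 / (k : ℝ))⌋₊ := by
  rw [ncard_powerRepsLE_succ hk]
  simp [ncard_powerRepsLE_zero_left]

theorem ncard_powerRepsLE_succ_zero {k : ℕ} (hk : k ≠ 0) (s : ℕ) :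
    (powerRepsLE k (s + 1) 0).ncard = 0 := by
  have hk' : (k : ℝ) ≠ 0 := by exact_mod_cast hk
  rw [ncard_powerRepsLE_succ hk]
  simp [Real.zero_rpow (inv_ne_zero hk')]

/-! ### The asymptotic formula -/

/-- The volume of the body `x₁ ^ k + ⋯ + xₛ ^ k ≤ 1` in the positive orthant. -/
noncomputable def orthantVolume (k s : ℕ) : ℝ :=
  Real.Gamma (1 + 1 / k) ^ s / Real.Gamma (1 + s / k)

theorem orthantVolume_nonneg (k s : ℕ) : 0 ≤ orthantVolume k s :=
  div_nonneg (pow_nonneg (Real.Gamma_nonneg_of_nonneg (by positivity)) _)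
    (Real.Gamma_nonneg_of_nonneg (by positivity))

theorem orthantVolume_succ {k : ℕ} (hk : k ≠ 0) (s : ℕ) :
    orthantVolume k (s + 1) =
      orthantVolume k s * ∫ t in (0 : ℝ)..1, powProfile k 1 ((s : ℝ) / k) t := by
  have hG : Real.Gamma (1 + s / k) ≠ 0 := (Real.Gamma_pos_of_pos (by positivity)).ne'
  have e : (1 : ℝ) + ((s + 1 : ℕ) : ℝ) / k = 1 + s / k + 1 / k := by push_cast; ring
  rw [integral_powProfile_one hk (by positivity)]
  unfold orthantVolume
  rw [e, pow_succ, div_mul_div_comm, ← mul_assoc,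
    mul_comm (Real.Gamma (1 + (s : ℝ) / k)) (Real.Gamma (1 + (s : ℝ) / k + 1 / k)),
    mul_div_mul_right _ _ hG]

section Asymptotics

variable {k : ℕ}

theorem rpow_inv_pow_natCast (hk : k ≠ 0) (n : ℕ) : ((n : ℝ) ^ (1 / (k : ℝ))) ^ k = n := by
  rw [one_div]; exact Real.rpow_inv_natCast_pow (Nat.cast_nonneg n) hk

theorem natCast_sub_pow_rpow (hk : k ≠ 0) (e : ℝ) {n m : ℕ}
    (hm : m ∈ Finset.Icc 1 ⌊(n : ℝ) ^ (1 / (k : ℝ))⌋₊) :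
    ((n - m ^ k : ℕ) : ℝ) ^ e = powProfile k ((n : ℝ) ^ (1 / (k : ℝ))) e m := by
  have := (le_floor_rpow_iff hk n m).1 (Finset.mem_Icc.1 hm).2
  unfold powProfile
  rw [rpow_inv_pow_natCast hk, Nat.cast_sub this, Nat.cast_pow]

/-- The power sums arising in the recursion on the number of variables. -/
theorem abs_sum_sub_pow_rpow_le (hk : k ≠ 0) {e : ℝ} (he : 0 < e) (he1 : e ≤ 1) {n : ℕ}
    (hn : 1 ≤ n) :
    |∑ m ∈ Finset.Icc 1 ⌊(n : ℝ) ^ (1 / (k : ℝ))⌋₊, ((n - m ^ k : ℕ) : ℝ) ^ e -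
      ((∫ t in (0 : ℝ)..1, powProfile k 1 e t) * (n : ℝ) ^ (e + 1 / k) - (n : ℝ) ^ e / 2)| ≤
        4 * k * (n : ℝ) ^ (e * (1 - 1 / k)) := by
  have hn0 : (0 : ℝ) < n := by exact_mod_cast hn
  have hk1 : (1 : ℝ) ≤ k := by exact_mod_cast Nat.one_le_iff_ne_zero.2 hk
  have hkR : (k : ℝ) ≠ 0 := by positivity
  rw [Finset.sum_congr rfl fun m hm => natCast_sub_pow_rpow hk e hm]
  set N := (n : ℝ) ^ (1 / (k : ℝ)) with hN
  have hN0 : 0 < N := by positivity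
  have hpow : ∀ y : ℝ, N ^ y = (n : ℝ) ^ (y / k) := by
    intro y
    rw [hN, ← Real.rpow_mul hn0.le]
    congr 1
    ring
  have h := abs_sum_powProfile_sub_le (k := k) he.le he1 (a := N) ⟨hN0.le, le_rfl⟩
  have hz : powProfile k N e N = 0 := by
    unfold powProfile; rw [sub_self, Real.zero_rpow he.ne']
  rw [hz, mul_zero, powProfile_zero hk hN0.le, integral_powProfile hN0, hpow, hpow] at h
  simp only [sub_zero] at h
  have e1 : ((k : ℝ) * e + 1) / k = e + 1 / k := by field_simp
  have e2 : (k : ℝ) * e / k = e := by field_simp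
  rw [e1, e2, mul_comm ((n : ℝ) ^ (e + 1 / k))] at h
  refine h.trans ?_
  rw [Real.mul_rpow (by positivity) (by positivity)]
  have h1 : (N ^ (k - 1)) ^ e = (n : ℝ) ^ (e * (1 - 1 / k)) := by
    rw [← Real.rpow_natCast, ← Real.rpow_mul hN0.le, hpow, Nat.cast_sub (by omega)]
    congr 1
    field_simp
    simp
  have h2 : (2 * (k : ℝ)) ^ e ≤ (2 * (k : ℝ)) ^ (1 : ℝ) :=
    Real.rpow_le_rpow_of_exponent_le (by linarith) he1
  rw [Real.rpow_one] at h2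
  rw [h1]
  calc 2 * ((2 * (k : ℝ)) ^ e * (n : ℝ) ^ (e * (1 - 1 / k)))
      ≤ 2 * ((2 * (k : ℝ)) * (n : ℝ) ^ (e * (1 - 1 / k))) := by gcongr
    _ = 4 * k * (n : ℝ) ^ (e * (1 - 1 / k)) := by ring

/-- The two-term asymptotic expansion for the number of `s`-tuples with bounded power sum. -/
def TwoTermExpansion (k s : ℕ) (C : ℝ) : Prop :=
  ∀ n : ℕ, 1 ≤ n → |((powerRepsLE k s n).ncard : ℝ) -
    (orthantVolume k s * (n : ℝ) ^ ((s : ℝ) / k) -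
      (s : ℝ) / 2 * orthantVolume k (s - 1) * (n : ℝ) ^ (((s : ℝ) - 1) / k))| ≤
        C * (n : ℝ) ^ (((s : ℝ) - 1 - 1 / k) / k)

/-- Columns under the curve contain `⌊F m⌋₊ = F m - 1 / 2 - sawtooth (F m)` points. The second term
`-N` is half from these `1 / 2`s and half from Euler–Maclaurin at `0`; the sawtooth sum goes into
the error. -/
theorem exists_twoTermExpansion_two (hk : 4 ≤ k) : ∃ C : ℝ, 0 ≤ C ∧ TwoTermExpansion k 2 C := by
  obtain ⟨C, hC0, hC⟩ := exists_bound_curveSawtoothSum k hk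
  refine ⟨C + 4 * k + 1, by positivity, ?_⟩
  intro n hn
  have hk0 : k ≠ 0 := by omega
  have hk4 : (4 : ℝ) ≤ k := by exact_mod_cast hk
  have hkR : (k : ℝ) ≠ 0 := by positivity
  have hn1 : (1 : ℝ) ≤ n := by exact_mod_cast hn
  have hkinv : 1 / (k : ℝ) ≤ 1 / 4 := one_div_le_one_div_of_le (by norm_num) hk4
  have hkinv0 : 0 < 1 / (k : ℝ) := by positivity
  have hsum := abs_sum_sub_pow_rpow_le hk0 (e := 1 / k) hkinv0 (by linarith) hn
  have hone : ∀ m ∈ Finset.Icc 1 ⌊(n : ℝ) ^ (1 / (k : ℝ))⌋₊,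
      (powerRepsLE k 1 (n - m ^ k)).ncard =
        ⌊powProfile k ((n : ℝ) ^ (1 / (k : ℝ))) (1 / k) m⌋₊ := by
    intro m hm
    rw [ncard_powerRepsLE_one hk0, natCast_sub_pow_rpow hk0 _ hm]
  rw [ncard_powerRepsLE_succ hk0, Finset.sum_congr rfl hone]
  rw [Finset.sum_congr rfl fun m hm => natCast_sub_pow_rpow hk0 (1 / (k : ℝ)) hm] at hsum
  set N := (n : ℝ) ^ (1 / (k : ℝ)) with hN
  have hN1 : 1 ≤ N := Real.one_le_rpow hn1 hkinv0.le
  have hS := curveSawtoothSum_eq hk0 (N := N) (a := N) ⟨by linarith, le_rfl⟩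
  have hSb := hC N hN1
  have v1 : orthantVolume k 1 = 1 := by
    unfold orthantVolume
    rw [pow_one, Nat.cast_one]
    exact div_self (Real.Gamma_pos_of_pos (by positivity)).ne'
  have v2 : orthantVolume k 2 = ∫ t in (0 : ℝ)..1, powProfile k 1 (1 / k) t := by
    have := orthantVolume_succ hk0 1
    rwa [v1, one_mul, Nat.cast_one] at this
  have x1 : N ^ (1 - 1 / (k : ℝ)) = (n : ℝ) ^ (((2 : ℕ) - 1 - 1 / (k : ℝ)) / k) := by
    rw [hN, ← Real.rpow_mul (by linarith)]
    congr 1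
    push_cast
    ring
  have x2 : (n : ℝ) ^ (1 / (k : ℝ) * (1 - 1 / k)) =
      (n : ℝ) ^ (((2 : ℕ) - 1 - 1 / (k : ℝ)) / k) := by
    congr 1
    push_cast
    ring
  have x3 : (n : ℝ) ^ (((2 : ℕ) : ℝ) / k) = (n : ℝ) ^ (1 / (k : ℝ) + 1 / k) := by
    congr 1
    push_cast
    ring
  have x4 : (n : ℝ) ^ ((((2 : ℕ) : ℝ) - 1) / k) = N := by
    rw [hN]
    congr 1
    push_cast
    ring
  have hbig : 1 ≤ (n : ℝ) ^ (((2 : ℕ) - 1 - 1 / (k : ℝ)) / k) := by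
    apply Real.one_le_rpow hn1
    push_cast
    apply div_nonneg _ (by positivity)
    linarith
  rw [x1] at hSb
  rw [x2] at hsum
  rw [x3, x4, v2, show 2 - 1 = 1 from rfl, v1]
  set X := (n : ℝ) ^ (((2 : ℕ) - 1 - 1 / (k : ℝ)) / k)
  have f1 := Nat.floor_le (zero_le_one.trans hN1)
  have f2 := Nat.lt_floor_add_one N
  have hx : (C + 4 * k + 1) * X = C * X + 4 * k * X + X := by ring
  rw [hx]
  push_cast at hS ⊢
  rw [abs_le] at hsum hSb ⊢
  constructor <;> linarith [hsum.1, hsum.2, hSb.1, hSb.2]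

/-- The error of the expansion for `s` variables, summed over at most `n ^ (1 / k)` values of `m`,
has exactly the admissible order; no further cancellation is needed. -/
theorem exists_twoTermExpansion_succ {s : ℕ} (hs : 2 ≤ s) (hsk : s + 1 ≤ k) {C : ℝ} (hC0 : 0 ≤ C)
    (hC : TwoTermExpansion k s C) : ∃ C' : ℝ, 0 ≤ C' ∧ TwoTermExpansion k (s + 1) C' := by
  have hvs := orthantVolume_nonneg k s
  have hvs1 := orthantVolume_nonneg k (s - 1)
  refine ⟨C + orthantVolume k s * (4 * k) + s / 2 * orthantVolume k (s - 1) * (4 * k + 1),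
    by positivity, ?_⟩
  intro n hn
  have hk0 : k ≠ 0 := by omega
  have hk1 : (1 : ℝ) ≤ k := by exact_mod_cast Nat.one_le_iff_ne_zero.2 hk0
  have hkR : (k : ℝ) ≠ 0 := by positivity
  have hs2 : (2 : ℝ) ≤ s := by exact_mod_cast hs
  have hskR : (s : ℝ) + 1 ≤ k := by exact_mod_cast hsk
  have hn1 : (1 : ℝ) ≤ n := by exact_mod_cast hn
  have hn0 : (0 : ℝ) < n := by linarith
  have hkinv1 : 1 / (k : ℝ) ≤ 1 := by rw [div_le_one (by linarith)]; exact hk1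
  have hkinv0 : 0 < 1 / (k : ℝ) := by positivity
  have hterm : ∀ m ∈ Finset.Icc 1 ⌊(n : ℝ) ^ (1 / (k : ℝ))⌋₊,
      |((powerRepsLE k s (n - m ^ k)).ncard : ℝ) -
        (orthantVolume k s * ((n - m ^ k : ℕ) : ℝ) ^ ((s : ℝ) / k) -
          (s : ℝ) / 2 * orthantVolume k (s - 1) * ((n - m ^ k : ℕ) : ℝ) ^ (((s : ℝ) - 1) / k))| ≤
        C * (n : ℝ) ^ (((s : ℝ) - 1 - 1 / k) / k) := by
    intro m hm
    -- The expansion assumes a positive argument. At `0` the count and both powers vanish, the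
    -- exponents being positive as `s ≥ 2`.
    rcases Nat.eq_zero_or_pos (n - m ^ k) with h0 | h0
    · obtain ⟨j, rfl⟩ : ∃ j, s = j + 1 := ⟨s - 1, by omega⟩
      rw [h0, ncard_powerRepsLE_succ_zero hk0, Nat.cast_zero,
        Real.zero_rpow (by positivity), Real.zero_rpow (div_ne_zero (by linarith) hkR)]
      simp only [mul_zero, sub_zero, abs_zero]
      positivity
    · refine (hC _ h0).trans ?_
      have : ((n - m ^ k : ℕ) : ℝ) ≤ n := Nat.cast_le.2 (Nat.sub_le _ _)
      gcongr
      exact div_nonneg (by linarith) (by positivity)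
  have hR : (⌊(n : ℝ) ^ (1 / (k : ℝ))⌋₊ : ℝ) ≤ (n : ℝ) ^ (1 / (k : ℝ)) :=
    Nat.floor_le (by positivity)
  set R := Finset.Icc 1 ⌊(n : ℝ) ^ (1 / (k : ℝ))⌋₊ with hRdef
  set X := (n : ℝ) ^ ((((s + 1 : ℕ) : ℝ) - 1 - 1 / k) / k) with hX
  have herr : |∑ m ∈ R, ((powerRepsLE k s (n - m ^ k)).ncard : ℝ) -
      (orthantVolume k s * ∑ m ∈ R, ((n - m ^ k : ℕ) : ℝ) ^ ((s : ℝ) / k) -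
        (s : ℝ) / 2 * orthantVolume k (s - 1) *
          ∑ m ∈ R, ((n - m ^ k : ℕ) : ℝ) ^ (((s : ℝ) - 1) / k))| ≤ C * X := by
    rw [Finset.mul_sum, Finset.mul_sum, ← Finset.sum_sub_distrib, ← Finset.sum_sub_distrib]
    refine (Finset.abs_sum_le_sum_abs _ _).trans ((Finset.sum_le_card_nsmul _ _ _ hterm).trans ?_)
    rw [hRdef, Nat.card_Icc, Nat.add_sub_cancel, nsmul_eq_mul]
    calc (⌊(n : ℝ) ^ (1 / (k : ℝ))⌋₊ : ℝ) * (C * (n : ℝ) ^ (((s : ℝ) - 1 - 1 / k) / k))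
        ≤ (n : ℝ) ^ (1 / (k : ℝ)) * (C * (n : ℝ) ^ (((s : ℝ) - 1 - 1 / k) / k)) := by gcongr
      _ = C * ((n : ℝ) ^ (1 / (k : ℝ)) * (n : ℝ) ^ (((s : ℝ) - 1 - 1 / k) / k)) := by ring
      _ = C * X := by
        rw [← Real.rpow_add hn0, hX]
        congr 2
        push_cast
        ring
  have h1 := abs_sum_sub_pow_rpow_le hk0 (e := (s : ℝ) / k) (by positivity)
    (by rw [div_le_one (by linarith)]; linarith) hn
  have h2 := abs_sum_sub_pow_rpow_le hk0 (e := ((s : ℝ) - 1) / k)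
    (div_pos (by linarith) (by linarith)) (by rw [div_le_one (by linarith)]; linarith) hn
  rw [← hRdef] at h1 h2
  -- After multiplying by `k`, the exponents compare as `s * (1 - 1 / k) ≤ s - 1 / k`, since `s ≥
  -- 1`.
  have y1 : (n : ℝ) ^ ((s : ℝ) / k * (1 - 1 / k)) ≤ X := by
    apply Real.rpow_le_rpow_of_exponent_le hn1
    rw [div_mul_eq_mul_div, div_le_div_iff_of_pos_right (by linarith)]
    push_cast
    nlinarith
  have y2 : (n : ℝ) ^ (((s : ℝ) - 1) / k * (1 - 1 / k)) ≤ X := by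
    apply Real.rpow_le_rpow_of_exponent_le hn1
    rw [div_mul_eq_mul_div, div_le_div_iff_of_pos_right (by linarith)]
    push_cast
    nlinarith
  have y3 : (n : ℝ) ^ (((s : ℝ) - 1) / k) ≤ X := by
    apply Real.rpow_le_rpow_of_exponent_le hn1
    rw [div_le_div_iff_of_pos_right (by linarith)]
    push_cast
    linarith
  have y30 : 0 ≤ (n : ℝ) ^ (((s : ℝ) - 1) / k) := by positivity
  have x1 : (n : ℝ) ^ (((s + 1 : ℕ) : ℝ) / k) = (n : ℝ) ^ ((s : ℝ) / k + 1 / k) := by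
    congr 1
    push_cast
    ring
  have x2 : (n : ℝ) ^ ((((s + 1 : ℕ) : ℝ) - 1) / k) = (n : ℝ) ^ ((s : ℝ) / k) := by
    congr 1
    push_cast
    ring
  have x3 : (n : ℝ) ^ (((s : ℝ) - 1) / k + 1 / k) = (n : ℝ) ^ ((s : ℝ) / k) := by
    congr 1
    ring
  have w1 := orthantVolume_succ hk0 s
  have w2 : orthantVolume k s = orthantVolume k (s - 1) *
      ∫ t in (0 : ℝ)..1, powProfile k 1 (((s : ℝ) - 1) / k) t := by
    have h := orthantVolume_succ hk0 (s - 1)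
    rwa [Nat.sub_add_cancel (by omega), Nat.cast_sub (by omega), Nat.cast_one] at h
  rw [x3] at h2
  rw [ncard_powerRepsLE_succ hk0, Nat.cast_sum, ← hRdef, Nat.add_sub_cancel, x1, x2]
  set S1 := ∑ m ∈ R, ((n - m ^ k : ℕ) : ℝ) ^ ((s : ℝ) / k)
  set S2 := ∑ m ∈ R, ((n - m ^ k : ℕ) : ℝ) ^ (((s : ℝ) - 1) / k)
  set I1 := ∫ t in (0 : ℝ)..1, powProfile k 1 ((s : ℝ) / k) t
  set I2 := ∫ t in (0 : ℝ)..1, powProfile k 1 (((s : ℝ) - 1) / k) t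
  set T := (n : ℝ) ^ ((s : ℝ) / k)
  set U := (n : ℝ) ^ ((s : ℝ) / k + 1 / k)
  have hk4 : 4 * k * (n : ℝ) ^ ((s : ℝ) / k * (1 - 1 / k)) ≤ 4 * k * X := by gcongr
  have hk4' : 4 * k * (n : ℝ) ^ (((s : ℝ) - 1) / k * (1 - 1 / k)) ≤ 4 * k * X := by gcongr
  have g1 : |S1 - (I1 * U - T / 2)| ≤ 4 * k * X := h1.trans hk4
  have g2 : |S2 - I2 * T| ≤ (4 * k + 1) * X := by
    rw [abs_le] at h2 ⊢
    constructor <;> linarith [h2.1, h2.2]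
  have m1 : |orthantVolume k s * (S1 - (I1 * U - T / 2))| ≤ orthantVolume k s * (4 * k * X) := by
    rw [abs_mul, abs_of_nonneg hvs]
    gcongr
  have m2 : |s / 2 * orthantVolume k (s - 1) * (S2 - I2 * T)| ≤
      s / 2 * orthantVolume k (s - 1) * ((4 * k + 1) * X) := by
    rw [abs_mul, abs_of_nonneg (a := (s : ℝ) / 2 * orthantVolume k (s - 1)) (by positivity)]
    gcongr
  -- The secondary terms add up: `s / 2` inherited from the previous expansion, and `1 / 2` from the
  -- endpoint correction of the leading sum.
  have hid : orthantVolume k (s + 1) * U - ((s + 1 : ℕ) : ℝ) / 2 * orthantVolume k s * T =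
      orthantVolume k s * (I1 * U - T / 2) - s / 2 * orthantVolume k (s - 1) * (I2 * T) := by
    have : s / 2 * orthantVolume k (s - 1) * (I2 * T) = s / 2 * (orthantVolume k (s - 1) * I2) * T := by
      ring
    rw [this, ← w2, w1]
    push_cast
    ring
  rw [hid]
  rw [abs_le] at herr m1 m2 ⊢
  constructor <;> linarith [herr.1, herr.2, m1.1, m1.2, m2.1, m2.2]

theorem exists_twoTermExpansion (hk : 4 ≤ k) {s : ℕ} (hs : 2 ≤ s) (hsk : s ≤ k) :
    ∃ C : ℝ, 0 ≤ C ∧ TwoTermExpansion k s C := by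
  induction s, hs using Nat.le_induction with
  | base => exact exists_twoTermExpansion_two hk
  | succ s hs ih =>
    obtain ⟨C, hC0, hC⟩ := ih (by omega)
    exact exists_twoTermExpansion_succ hs hsk hC0 hC

/-- The two-term expansion for the diagonal summatory function at integers. -/
theorem exists_bound_sum_powerRepCountDiag (hk : 4 ≤ k) :
    ∃ C : ℝ, 0 ≤ C ∧ ∀ n : ℕ, 1 ≤ n →
      |(∑ m ∈ Finset.Icc 1 n, (powerRepCountDiag k m : ℝ)) -
          (Real.Gamma (((k : ℝ) + 1) / k) ^ k * (n : ℝ) -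
            (k : ℝ) / 2 *
              (Real.Gamma (((k : ℝ) + 1) / k) ^ (k - 1) / Real.Gamma ((2 * (k : ℝ) - 1) / k)) *
              (n : ℝ) ^ (1 - 1 / (k : ℝ)))|
        ≤ C * (n : ℝ) ^ (((k : ℝ) ^ 2 - k - 1) / (k : ℝ) ^ 2) := by
  obtain ⟨C, hC0, hC⟩ := exists_twoTermExpansion hk (by omega) le_rfl
  refine ⟨C, hC0, fun n hn => ?_⟩
  have hk0 : k ≠ 0 := by omega
  have hkR : (k : ℝ) ≠ 0 := by exact_mod_cast hk0
  have hsum : (∑ m ∈ Finset.Icc 1 n, (powerRepCountDiag k m : ℝ)) =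
      ((powerRepsLE k k n).ncard : ℝ) := by
    have h0 : powerRepCount k k 0 = 0 := by
      obtain ⟨j, rfl⟩ : ∃ j, k = j + 1 := ⟨k - 1, by omega⟩
      have := ncard_powerRepsLE_eq_sum hk0 (j + 1) 0
      rw [ncard_powerRepsLE_succ_zero hk0] at this
      simpa using this.symm
    rw [ncard_powerRepsLE_eq_sum hk0, Finset.sum_range_succ', h0, add_zero, Nat.cast_sum,
      Finset.range_eq_Ico,
      Finset.sum_Ico_add' (fun m => (powerRepCount k k m : ℝ)) 0 n 1, zero_add]
    rfl
  have h := hC n hn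
  have g1 : orthantVolume k k = Real.Gamma (((k : ℝ) + 1) / k) ^ k := by
    unfold orthantVolume
    rw [div_self hkR, one_add_one_eq_two, Real.Gamma_two, div_one, add_div, div_self hkR]
  have g2 : orthantVolume k (k - 1) =
      Real.Gamma (((k : ℝ) + 1) / k) ^ (k - 1) / Real.Gamma ((2 * (k : ℝ) - 1) / k) := by
    unfold orthantVolume
    rw [Nat.cast_sub (by omega), Nat.cast_one, add_div, div_self hkR]
    congr 2
    field_simp
    ring
  have e1 : ((k : ℝ) - 1) / k = 1 - 1 / k := by field_simp
  have e2 : ((k : ℝ) - 1 - 1 / k) / k = ((k : ℝ) ^ 2 - k - 1) / (k : ℝ) ^ 2 := by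
    field_simp
  rw [g1, g2, div_self hkR, Real.rpow_one, e1, e2] at h
  rw [hsum]
  exact h

end Asymptotics

theorem mainTheorem2 (k : ℕ) (hk : 4 ≤ k) :
    (∃ C : ℝ, ∀ n : ℕ, 1 ≤ n →
      |(∑ m ∈ Finset.Icc 1 n, (powerRepCountDiag k m : ℝ)) -
          (Real.Gamma (((k : ℝ) + 1) / k) ^ k * (n : ℝ) -
            (k : ℝ) / 2 *
              (Real.Gamma (((k : ℝ) + 1) / k) ^ (k - 1) / Real.Gamma ((2 * (k : ℝ) - 1) / k)) *
              (n : ℝ) ^ (1 - 1 / (k : ℝ)))|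
        ≤ C * (n : ℝ) ^ (((k : ℝ) ^ 2 - k - 1) / (k : ℝ) ^ 2)) ∧
    (∃ C : ℝ, ∀ x : ℝ, 1 ≤ x →
      |(∑ m ∈ Finset.Icc 1 ⌊x⌋₊, (powerRepCountDiag k m : ℝ)) -
          (Real.Gamma (((k : ℝ) + 1) / k) ^ k * x -
            (k : ℝ) / 2 *
              (Real.Gamma (((k : ℝ) + 1) / k) ^ (k - 1) / Real.Gamma ((2 * (k : ℝ) - 1) / k)) *
              x ^ (1 - 1 / (k : ℝ)))|
        ≤ C * x ^ (((k : ℝ) ^ 2 - k - 1) / (k : ℝ) ^ 2)) := by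
  obtain ⟨C, hC0, hC⟩ := exists_bound_sum_powerRepCountDiag hk
  refine ⟨⟨C, hC⟩, ?_⟩
  set G := Real.Gamma (((k : ℝ) + 1) / k) ^ k with hG
  set H := (k : ℝ) / 2 *
    (Real.Gamma (((k : ℝ) + 1) / k) ^ (k - 1) / Real.Gamma ((2 * (k : ℝ) - 1) / k)) with hH
  have hk4 : (4 : ℝ) ≤ k := by exact_mod_cast hk
  have hk0 : (0 : ℝ) < k := by linarith
  have hG0 : 0 ≤ G := pow_nonneg (Real.Gamma_nonneg_of_nonneg (by positivity)) _
  have hH0 : 0 ≤ H := mul_nonneg (by positivity)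
    (div_nonneg (pow_nonneg (Real.Gamma_nonneg_of_nonneg (by positivity)) _)
      (Real.Gamma_nonneg_of_nonneg (div_nonneg (by linarith) hk0.le)))
  -- Passing from `⌊x⌋₊` to `x` changes the main terms by at most `G` and `H`, and these are
  -- absorbed because the error power of `x` is at least `1`.
  refine ⟨C + G + H, fun x hx => ?_⟩
  have hx0 : 0 ≤ x := zero_le_one.trans hx
  have hn : 1 ≤ ⌊x⌋₊ := (Nat.one_le_floor_iff x).2 hx
  have h := hC ⌊x⌋₊ hn
  have f1 := Nat.floor_le hx0
  have f2 := Nat.lt_floor_add_one x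
  have hE : 0 ≤ ((k : ℝ) ^ 2 - k - 1) / (k : ℝ) ^ 2 := div_nonneg (by nlinarith) (by positivity)
  have hX1 : 1 ≤ x ^ (((k : ℝ) ^ 2 - k - 1) / (k : ℝ) ^ 2) := Real.one_le_rpow hx hE
  have hX2 : C * (⌊x⌋₊ : ℝ) ^ (((k : ℝ) ^ 2 - k - 1) / (k : ℝ) ^ 2) ≤
      C * x ^ (((k : ℝ) ^ 2 - k - 1) / (k : ℝ) ^ 2) := by gcongr
  have hp0 : 0 ≤ 1 - 1 / (k : ℝ) := by
    rw [sub_nonneg, div_le_one hk0]; linarith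
  have hp1 : 1 - 1 / (k : ℝ) ≤ 1 := by linarith [show 0 ≤ 1 / (k : ℝ) by positivity]
  have hlow : (⌊x⌋₊ : ℝ) ^ (1 - 1 / (k : ℝ)) ≤ x ^ (1 - 1 / (k : ℝ)) := by gcongr
  -- Subadditivity of a power with exponent in `[0, 1]`, applied to integer part plus fractional
  -- part.
  have hup : x ^ (1 - 1 / (k : ℝ)) ≤ (⌊x⌋₊ : ℝ) ^ (1 - 1 / (k : ℝ)) + 1 := by
    have hsub : 0 ≤ x - ⌊x⌋₊ := sub_nonneg.2 f1
    have h1 := NNReal.rpow_add_le_add_rpow (⌊x⌋₊ : NNReal) ⟨_, hsub⟩ hp0 hp1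
    have h2 : ((⌊x⌋₊ : ℝ) + (x - ⌊x⌋₊)) ^ (1 - 1 / (k : ℝ)) ≤
        (⌊x⌋₊ : ℝ) ^ (1 - 1 / (k : ℝ)) + (x - ⌊x⌋₊) ^ (1 - 1 / (k : ℝ)) := by
      exact_mod_cast h1
    rw [add_sub_cancel] at h2
    have h3 : (x - ⌊x⌋₊) ^ (1 - 1 / (k : ℝ)) ≤ 1 := Real.rpow_le_one hsub (by linarith) hp0
    linarith
  set X := x ^ (((k : ℝ) ^ 2 - k - 1) / (k : ℝ) ^ 2)
  set p := (⌊x⌋₊ : ℝ) ^ (1 - 1 / (k : ℝ))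
  have m1 : 0 ≤ G * (x - ⌊x⌋₊) := mul_nonneg hG0 (by linarith)
  have m2 : G * (x - ⌊x⌋₊) ≤ G * X := mul_le_mul_of_nonneg_left (by linarith) hG0
  have m3 : 0 ≤ H * (x ^ (1 - 1 / (k : ℝ)) - p) := mul_nonneg hH0 (by linarith)
  have m4 : H * (x ^ (1 - 1 / (k : ℝ)) - p) ≤ H * X := mul_le_mul_of_nonneg_left (by linarith) hH0
  rw [abs_le] at h ⊢
  constructor <;> linarith [h.1, h.2]
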